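/- A \emph{mosaic floorplan} is a dissection of an axis-parallel rectangle into finitely many nondegenerate axis-parallel rectangles (rooms) without cross junctions, i.e. no point is the common corner of four rooms. Two mosaic floorplans are \emph{equivalent} if their rooms and their (maximal horizontal and vertical) segments can be matched bijectively so that a segment contains the left (respectively right, top, bottom) edge of a room if and only if the matched segment contains the left (respectively right, top, bottom) edge of the matched room. The \emph{top-left block deletion} removes the room $b$ at the top left corner: if the bottom-right corner of $b$ is a $\dashv$-junction (respectively a $\perp$-junction), the bottom (respectively right) edge of $b$ is shifted upwards (respectively leftwards) until it hits the bounding rectangle, the rooms attached to it from the other side being prolonged; bottom-left block deletion is defined in the same way with top and bottom exchanged. A mosaic floorplan $f$ with $n$ rooms \emph{corresponds to} the permutation $\pi\in S_n$ if, after labelling its rooms $1,\dots,n$ in the order in which repeated top-left block deletion removes them (the room that remains coming last), the labels listed in the bottom-left deletion order are $\pi[1],\dots,\pi[n]$. A permutation $\pi\in S_n$ is \emph{Baxter} if there are no indices $i<j<k<l$ with $\pi[k]<\pi[i]+1=\pi[l]<\pi[j]$ or $\pi[j]<\pi[i]=\pi[l]+1<\pi[k]$. The \emph{reverse} of $\pi$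 is $\pi^{r}$ with $\pi^{r}[i]=\pi[n+1-i]$. \textbf{Theorem.} If $\pi$ is a Baxter permutation, then so is its reverse $\pi^{r}$. Moreover, the mosaic floorplan corresponding to $\pi^{r}$ is obtained from the mosaic floorplan corresponding to $\pi$ by rotating it clockwise by $90^\circ$ and then reflecting it in the vertical axis (exchanging left and right). That is: if a mosaic floorplan $f$ corresponds to $\pi$, and $f'$ is the image of $f$ under these two operations, then $f'$ is a mosaic floorplan corresponding to $\pi^{r}$, and a mosaic floorplan corresponds to $\pi^{r}$ if and only if it is equivalent to $f'$. -/

import Mathlib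

namespace Floorplan

/-! ### Permutations -/

/-- Baxter permutations, in one-line notation `π 0, π 1, …, π (n - 1)`. -/
def IsBaxter {n : ℕ} (π : Equiv.Perm (Fin n)) : Prop :=
  ¬ ∃ i j k l : Fin n, i < j ∧ j < k ∧ k < l ∧
    (((π k : ℕ) < (π i : ℕ) + 1 ∧ (π i : ℕ) + 1 = (π l : ℕ) ∧ (π l : ℕ) < (π j : ℕ)) ∨
     ((π j : ℕ) < (π i : ℕ) ∧ (π i : ℕ) = (π l : ℕ) + 1 ∧ (π l : ℕ) + 1 < (π k : ℕ)))

/-- The reverse of a permutation: its one-line notation read backwards. -/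
def reverse {n : ℕ} (π : Equiv.Perm (Fin n)) : Equiv.Perm (Fin n) :=
  Fin.revPerm.trans π

/-! ### Rectangles

The plane is `ℝ × ℝ`, the first axis pointing to the right and the second one upwards. -/

/-- An axis-parallel rectangle, given by the abscissae of its left and right sides and the
ordinates of its bottom and top sides. -/
@[ext]
structure Rect where
  left : ℝ
  right : ℝ
  bottom : ℝ
  top : ℝ

namespace Rect

/-- The rectangle is nondegenerate. -/
def Proper (R : Rect) : Prop := R.left < R.right ∧ R.bottom < R.top

/-- The closed region bounded by the rectangle. -/
def region (R : Rect) : Set (ℝ × ℝ) := Set.Icc R.left R.right ×ˢ Set.Icc R.bottom R.top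

/-- The open region bounded by the rectangle. -/
def openRegion (R : Rect) : Set (ℝ × ℝ) := Set.Ioo R.left R.right ×ˢ Set.Ioo R.bottom R.top

def leftEdge (R : Rect) : Set (ℝ × ℝ) := {R.left} ×ˢ Set.Icc R.bottom R.top

def rightEdge (R : Rect) : Set (ℝ × ℝ) := {R.right} ×ˢ Set.Icc R.bottom R.top

def bottomEdge (R : Rect) : Set (ℝ × ℝ) := Set.Icc R.left R.right ×ˢ {R.bottom}

def topEdge (R : Rect) : Set (ℝ × ℝ) := Set.Icc R.left R.right ×ˢ {R.top}

/-- The image under the clockwise rotation by 90 degrees about the origin,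
`(x, y) ↦ (y, -x)`. -/
def rotateCW (R : Rect) : Rect where
  left := R.bottom
  right := R.top
  bottom := -R.right
  top := -R.left

/-- The image under the reflection in the vertical axis, `(x, y) ↦ (-x, y)`. -/
def reflectVertical (R : Rect) : Rect where
  left := -R.right
  right := -R.left
  bottom := R.bottom
  top := R.top

/-- The image under the reflection in the horizontal axis, `(x, y) ↦ (x, -y)`. -/
def reflectHorizontal (R : Rect) : Rect where
  left := R.left
  right := R.right
  bottom := -R.top
  top := -R.bottom

end Rect

/-! ### Dissections and mosaic floorplans -/

/-- A bounding rectangle together with a finite family of rectangles, the rooms. The elements of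
`rooms : Finset ι` are the names of the rooms; the value of `room` at other names is irrelevant. -/
structure Dissection (ι : Type*) where
  box : Rect
  rooms : Finset ι
  room : ι → Rect

namespace Dissection

variable {ι κ : Type*}

/-- The union of the edges of all rooms. -/
def walls (f : Dissection ι) : Set (ℝ × ℝ) :=
  ⋃ i ∈ f.rooms, ((f.room i).leftEdge ∪ (f.room i).rightEdge ∪
    (f.room i).bottomEdge ∪ (f.room i).topEdge)

/-- The walls contain a nondegenerate line segment which starts at `p` in direction `d`. -/
def HasArm (f : Dissection ι) (p d : ℝ × ℝ) : Prop :=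
  ∃ ε : ℝ, 0 < ε ∧ ∀ t : ℝ, 0 ≤ t → t ≤ ε → p + t • d ∈ f.walls

/-- The point `p` is a cross junction. -/
def IsCross (f : Dissection ι) (p : ℝ × ℝ) : Prop :=
  f.HasArm p (1, 0) ∧ f.HasArm p (-1, 0) ∧ f.HasArm p (0, 1) ∧ f.HasArm p (0, -1)

/-- The point `p` is a `⊣`-junction: a horizontal segment arrives from the left at an inner point
of a vertical segment and ends there. -/
def IsLeftTee (f : Dissection ι) (p : ℝ × ℝ) : Prop :=
  ¬ f.HasArm p (1, 0) ∧ f.HasArm p (-1, 0) ∧ f.HasArm p (0, 1) ∧ f.HasArm p (0, -1)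

/-- The point `p` is a `⊥`-junction: a vertical segment arrives from above at an inner point
of a horizontal segment and ends there. -/
def IsUpTee (f : Dissection ι) (p : ℝ × ℝ) : Prop :=
  f.HasArm p (1, 0) ∧ f.HasArm p (-1, 0) ∧ f.HasArm p (0, 1) ∧ ¬ f.HasArm p (0, -1)

/-- Mosaic floorplans: the rooms are nondegenerate, tile the bounding rectangle, and there is no
cross junction. -/
structure IsMosaic (f : Dissection ι) : Prop where
  box_proper : f.box.Proper
  room_proper : ∀ i ∈ f.rooms, (f.room i).Proper
  disjoint : ∀ i ∈ f.rooms, ∀ j ∈ f.rooms, i ≠ j →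
    Disjoint (f.room i).openRegion (f.room j).openRegion
  cover : ⋃ i ∈ f.rooms, (f.room i).region = f.box.region
  no_cross : ∀ p, ¬ f.IsCross p

/-! ### Equivalence of floorplans -/

/-- A nondegenerate horizontal or vertical line segment. -/
def IsAxisSegment (s : Set (ℝ × ℝ)) : Prop :=
  (∃ x a b : ℝ, a < b ∧ s = {x} ×ˢ Set.Icc a b) ∨ (∃ y a b : ℝ, a < b ∧ s = Set.Icc a b ×ˢ {y})

/-- The segments of a floorplan are the maximal horizontal and vertical line segments formed by
its walls (the four sides of the bounding rectangle are among them). -/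
def IsSegment (f : Dissection ι) (s : Set (ℝ × ℝ)) : Prop :=
  Maximal (fun t : Set (ℝ × ℝ) => IsAxisSegment t ∧ t ⊆ f.walls) s

/-- Two floorplans are equivalent if their rooms and their segments can be matched so that they
hold the same left-, right-, bottom- and top-seg-room relations. -/
def Equivalent (f : Dissection ι) (g : Dissection κ) : Prop :=
  ∃ (e : {i // i ∈ f.rooms} ≃ {j // j ∈ g.rooms}) (φ : {s // f.IsSegment s} ≃ {s // g.IsSegment s}),
    ∀ (s : {s // f.IsSegment s}) (i : {i // i ∈ f.rooms}),
      ((f.room i).leftEdge ⊆ s.1 ↔ (g.room (e i)).leftEdge ⊆ (φ s).1) ∧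
      ((f.room i).rightEdge ⊆ s.1 ↔ (g.room (e i)).rightEdge ⊆ (φ s).1) ∧
      ((f.room i).bottomEdge ⊆ s.1 ↔ (g.room (e i)).bottomEdge ⊆ (φ s).1) ∧
      ((f.room i).topEdge ⊆ s.1 ↔ (g.room (e i)).topEdge ⊆ (φ s).1)

/-! ### Geometric operations -/

/-- Apply an operation on rectangles to the bounding rectangle and to every room. -/
def map (T : Rect → Rect) (f : Dissection ι) : Dissection ι where
  box := T f.box
  rooms := f.rooms
  room i := T (f.room i)

/-- Clockwise rotation by 90 degrees. -/
def rotateCW (f : Dissection ι) : Dissection ι := f.map Rect.rotateCW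

/-- Reflection in the vertical axis (left and right are exchanged). -/
def reflectVertical (f : Dissection ι) : Dissection ι := f.map Rect.reflectVertical

/-- Reflection in the horizontal axis (top and bottom are exchanged). -/
def reflectHorizontal (f : Dissection ι) : Dissection ι := f.map Rect.reflectHorizontal

/-! ### Block deletion and the permutation of a floorplan -/

variable [DecidableEq ι]

/-- Remove the room `b` by shifting its bottom edge upwards to its top edge: the rooms that hang
below this edge are prolonged upwards. -/
noncomputable def shiftBottomUp (f : Dissection ι) (b : ι) : Dissection ι where
  box := f.box
  rooms := f.rooms.erase b
  room i :=
    if (f.room i).top = (f.room b).bottom ∧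
        (f.room b).left ≤ (f.room i).left ∧ (f.room i).right ≤ (f.room b).right then
      { f.room i with top := (f.room b).top }
    else f.room i

/-- Remove the room `b` by shifting its right edge leftwards to its left edge: the rooms that are
attached to this edge from the right are prolonged leftwards. -/
noncomputable def shiftRightLeft (f : Dissection ι) (b : ι) : Dissection ι where
  box := f.box
  rooms := f.rooms.erase b
  room i :=
    if (f.room i).left = (f.room b).right ∧
        (f.room b).bottom ≤ (f.room i).bottom ∧ (f.room i).top ≤ (f.room b).top then
      { f.room i with left := (f.room b).left }
    else f.room i

/-- The room `b` contains the top left corner of the bounding rectangle. -/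
def IsTopLeftRoom (f : Dissection ι) (b : ι) : Prop :=
  b ∈ f.rooms ∧ (f.room b).left = f.box.left ∧ (f.room b).top = f.box.top

/-- `f'` arises from `f` by the top-left block deletion, and `b` is the deleted block. -/
def IsTopLeftDeletion (f : Dissection ι) (b : ι) (f' : Dissection ι) : Prop :=
  f.IsTopLeftRoom b ∧
    ((f.IsLeftTee ((f.room b).right, (f.room b).bottom) ∧ f' = f.shiftBottomUp b) ∨
     (f.IsUpTee ((f.room b).right, (f.room b).bottom) ∧ f' = f.shiftRightLeft b))

/-- The list of the rooms in the order in which repeated top-left block deletion removes them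
(the last entry being the room that remains in the end). -/
inductive IsTopLeftOrder : Dissection ι → List ι → Prop
  | last (f : Dissection ι) (b : ι) (h : f.rooms = {b}) : IsTopLeftOrder f [b]
  | delete (f f' : Dissection ι) (b : ι) (l : List ι) (h : f.IsTopLeftDeletion b f')
      (hl : IsTopLeftOrder f' l) : IsTopLeftOrder f (b :: l)

/-- The bottom-left deletion order, which is defined as the top-left one with the roles of top
and bottom exchanged. -/
def IsBottomLeftOrder (f : Dissection ι) (l : List ι) : Prop :=
  f.reflectHorizontal.IsTopLeftOrder l

/-- The mosaic floorplan `f` corresponds to the permutation `π` of `n` letters: if its rooms are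
labelled in their top-left deletion order `σ`, then `π 0, …, π (n - 1)` are their labels listed
in the bottom-left deletion order `τ`. -/
def CorrespondsTo (f : Dissection ι) {n : ℕ} (π : Equiv.Perm (Fin n)) : Prop :=
  f.IsMosaic ∧ ∃ σ τ : Fin n → ι,
    f.IsTopLeftOrder (List.ofFn σ) ∧ f.IsBottomLeftOrder (List.ofFn τ) ∧ ∀ k, τ k = σ (π k)

end Dissection

end Floorplan

/-! Rotating clockwise and then exchanging left and right is the single reflection `(x, y) ↦ (-y,
-x)`, called antitransposition. It fixes the top left corner and sends the top right corner to the
bottom left one. It exchanges the two junction types of block deletion, so the top-left deletion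
order is unchanged. What has to be shown is that the bottom-left order is reversed.

Both orders are controlled by two relations between rooms: `LeftOf` (the right edge of one room and
the left edge of the other lie on one segment) and `Above`. Deleting a corner room does not change
these relations among the remaining rooms, so the top-left order is a linear extension of `LeftOf`
together with `Above`, and the bottom-left order one of `LeftOf` together with the inverse of
`Above`. Any two rooms are comparable through a chain of one of the relations
(`IsMosaic.comparable`), hence each linear extension is unique (`IsLinearExtension.unique`).
Antitransposition swaps `LeftOf` and `Above`; this inverts the second pair of relations and so
reverses the bottom-left order (`CorrespondsTo.antitranspose`).

For the classification up to equivalence, the permutation determines the chains: a room is left of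
another iff it precedes it in both orders, and above it iff it precedes it in the top-left order
only. `LeftOf` and `Above` are the covering relations of these chain orders, so floorplans with the
same permutation have isomorphic relations, and an isomorphism of relations transports the
permutation. Finally, the relations decide which edges lie on a common segment, and every segment
contains an edge; so isomorphism of relations is the same as equivalence
(`Equivalent.exists_isRelIso`, `IsRelIso.equivalent`). -/

namespace Floorplan

/-! ### Symmetries -/

/-- The image under the reflection `(x, y) ↦ (-y, -x)`, which fixes the top left corner. -/
def Rect.antitranspose (R : Rect) : Rect where
  left := -R.top
  right := -R.bottom
  bottom := -R.right
  top := -R.left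

namespace Dissection

variable {ι κ : Type*}

/-- The image under the reflection `(x, y) ↦ (-y, -x)`. -/
def antitranspose (f : Dissection ι) : Dissection ι := f.map Rect.antitranspose

@[simp] lemma antitranspose_box (f : Dissection ι) :
    f.antitranspose.box = f.box.antitranspose := rfl

@[simp] lemma antitranspose_rooms (f : Dissection ι) : f.antitranspose.rooms = f.rooms := rfl

@[simp] lemma antitranspose_room (f : Dissection ι) (i : ι) :
    f.antitranspose.room i = (f.room i).antitranspose := rfl

@[simp] lemma reflectHorizontal_box (f : Dissection ι) :
    f.reflectHorizontal.box = f.box.reflectHorizontal := rfl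

@[simp] lemma reflectHorizontal_rooms (f : Dissection ι) :
    f.reflectHorizontal.rooms = f.rooms := rfl

@[simp] lemma reflectHorizontal_room (f : Dissection ι) (i : ι) :
    f.reflectHorizontal.room i = (f.room i).reflectHorizontal := rfl

@[simp] lemma antitranspose_antitranspose (f : Dissection ι) :
    f.antitranspose.antitranspose = f := by
  simp [antitranspose, map, Rect.antitranspose]

lemma mem_walls {f : Dissection ι} {x y : ℝ} : (x, y) ∈ f.walls ↔ ∃ i ∈ f.rooms,
    ((x = (f.room i).left ∨ x = (f.room i).right) ∧ (f.room i).bottom ≤ y ∧ y ≤ (f.room i).top) ∨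
    ((y = (f.room i).bottom ∨ y = (f.room i).top) ∧
      (f.room i).left ≤ x ∧ x ≤ (f.room i).right) := by
  simp only [walls, Rect.leftEdge, Rect.rightEdge, Rect.bottomEdge, Rect.topEdge, Set.mem_iUnion,
    Set.mem_union, Set.mem_prod, Set.mem_singleton_iff, Set.mem_Icc, exists_prop]
  refine exists_congr fun i => and_congr_right fun _ => ?_
  tauto

lemma mem_walls_antitranspose {f : Dissection ι} {x y : ℝ} :
    (x, y) ∈ f.antitranspose.walls ↔ (-y, -x) ∈ f.walls := by
  simp only [mem_walls, antitranspose_rooms, antitranspose_room, Rect.antitranspose]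
  refine exists_congr fun i => and_congr_right fun _ => ?_
  constructor <;> rintro (⟨h | h, h1, h2⟩ | ⟨h | h, h1, h2⟩)
  · exact .inr ⟨.inr (by linarith), by linarith, by linarith⟩
  · exact .inr ⟨.inl (by linarith), by linarith, by linarith⟩
  · exact .inl ⟨.inr (by linarith), by linarith, by linarith⟩
  · exact .inl ⟨.inl (by linarith), by linarith, by linarith⟩
  · exact .inr ⟨.inr (by linarith), by linarith, by linarith⟩
  · exact .inr ⟨.inl (by linarith), by linarith, by linarith⟩
  · exact .inl ⟨.inr (by linarith), by linarith, by linarith⟩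
  · exact .inl ⟨.inl (by linarith), by linarith, by linarith⟩

lemma mem_walls_reflectHorizontal {f : Dissection ι} {x y : ℝ} :
    (x, y) ∈ f.reflectHorizontal.walls ↔ (x, -y) ∈ f.walls := by
  simp only [mem_walls, reflectHorizontal_rooms, reflectHorizontal_room, Rect.reflectHorizontal]
  refine exists_congr fun i => and_congr_right fun _ => ?_
  constructor <;> rintro (⟨h | h, h1, h2⟩ | ⟨h | h, h1, h2⟩)
  · exact .inl ⟨.inl h, by linarith, by linarith⟩
  · exact .inl ⟨.inr h, by linarith, by linarith⟩
  · exact .inr ⟨.inr (by linarith), by linarith, by linarith⟩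
  · exact .inr ⟨.inl (by linarith), by linarith, by linarith⟩
  · exact .inl ⟨.inl h, by linarith, by linarith⟩
  · exact .inl ⟨.inr h, by linarith, by linarith⟩
  · exact .inr ⟨.inr (by linarith), by linarith, by linarith⟩
  · exact .inr ⟨.inl (by linarith), by linarith, by linarith⟩

lemma hasArm_antitranspose {f : Dissection ι} {x y u v : ℝ} :
    f.antitranspose.HasArm (x, y) (u, v) ↔ f.HasArm (-y, -x) (-v, -u) := by
  simp only [HasArm, Prod.smul_mk, Prod.mk_add_mk, mem_walls_antitranspose, smul_eq_mul, neg_add,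
    mul_neg]

lemma hasArm_reflectHorizontal {f : Dissection ι} {x y u v : ℝ} :
    f.reflectHorizontal.HasArm (x, y) (u, v) ↔ f.HasArm (x, -y) (u, -v) := by
  simp only [HasArm, Prod.smul_mk, Prod.mk_add_mk, mem_walls_reflectHorizontal, smul_eq_mul,
    neg_add, mul_neg]

lemma isCross_antitranspose {f : Dissection ι} {x y : ℝ} :
    f.antitranspose.IsCross (x, y) ↔ f.IsCross (-y, -x) := by
  simp only [IsCross, hasArm_antitranspose, neg_zero, neg_neg]
  tauto

lemma isCross_reflectHorizontal {f : Dissection ι} {x y : ℝ} :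
    f.reflectHorizontal.IsCross (x, y) ↔ f.IsCross (x, -y) := by
  simp only [IsCross, hasArm_reflectHorizontal, neg_zero, neg_neg]
  tauto

lemma isLeftTee_antitranspose {f : Dissection ι} {x y : ℝ} :
    f.antitranspose.IsLeftTee (x, y) ↔ f.IsUpTee (-y, -x) := by
  simp only [IsLeftTee, IsUpTee, hasArm_antitranspose, neg_zero, neg_neg]
  tauto

lemma isUpTee_antitranspose {f : Dissection ι} {x y : ℝ} :
    f.antitranspose.IsUpTee (x, y) ↔ f.IsLeftTee (-y, -x) := by
  simp only [IsLeftTee, IsUpTee, hasArm_antitranspose, neg_zero, neg_neg]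
  tauto

end Dissection

/-! ### Regions, tilings and mosaics under the two reflections -/

namespace Rect

lemma mem_region {R : Rect} {x y : ℝ} :
    (x, y) ∈ R.region ↔ (R.left ≤ x ∧ x ≤ R.right) ∧ R.bottom ≤ y ∧ y ≤ R.top := Iff.rfl

lemma mem_openRegion {R : Rect} {x y : ℝ} :
    (x, y) ∈ R.openRegion ↔ (R.left < x ∧ x < R.right) ∧ R.bottom < y ∧ y < R.top := Iff.rfl

lemma mem_region_antitranspose {R : Rect} {x y : ℝ} :
    (x, y) ∈ R.antitranspose.region ↔ (-y, -x) ∈ R.region := by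
  simp only [mem_region, antitranspose]
  constructor <;> rintro ⟨⟨_, _⟩, _, _⟩ <;> refine ⟨⟨?_, ?_⟩, ?_, ?_⟩ <;> linarith

lemma mem_openRegion_antitranspose {R : Rect} {x y : ℝ} :
    (x, y) ∈ R.antitranspose.openRegion ↔ (-y, -x) ∈ R.openRegion := by
  simp only [mem_openRegion, antitranspose]
  constructor <;> rintro ⟨⟨_, _⟩, _, _⟩ <;> refine ⟨⟨?_, ?_⟩, ?_, ?_⟩ <;> linarith

lemma mem_region_reflectHorizontal {R : Rect} {x y : ℝ} :
    (x, y) ∈ R.reflectHorizontal.region ↔ (x, -y) ∈ R.region := by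
  simp only [mem_region, reflectHorizontal]
  constructor <;> rintro ⟨⟨_, _⟩, _, _⟩ <;> refine ⟨⟨?_, ?_⟩, ?_, ?_⟩ <;> linarith

lemma mem_openRegion_reflectHorizontal {R : Rect} {x y : ℝ} :
    (x, y) ∈ R.reflectHorizontal.openRegion ↔ (x, -y) ∈ R.openRegion := by
  simp only [mem_openRegion, reflectHorizontal]
  constructor <;> rintro ⟨⟨_, _⟩, _, _⟩ <;> refine ⟨⟨?_, ?_⟩, ?_, ?_⟩ <;> linarith

lemma Proper.antitranspose {R : Rect} (h : R.Proper) : R.antitranspose.Proper :=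
  ⟨neg_lt_neg h.2, neg_lt_neg h.1⟩

lemma Proper.reflectHorizontal {R : Rect} (h : R.Proper) : R.reflectHorizontal.Proper :=
  ⟨h.1, neg_lt_neg h.2⟩

end Rect

namespace Dissection

variable {ι κ : Type*}

/-- The rooms are nondegenerate and tile the bounding rectangle. -/
structure IsTiling (f : Dissection ι) : Prop where
  box_proper : f.box.Proper
  room_proper : ∀ i ∈ f.rooms, (f.room i).Proper
  disjoint : ∀ i ∈ f.rooms, ∀ j ∈ f.rooms, i ≠ j →
    Disjoint (f.room i).openRegion (f.room j).openRegion
  cover : ⋃ i ∈ f.rooms, (f.room i).region = f.box.region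

lemma IsTiling.antitranspose {f : Dissection ι} (h : f.IsTiling) : f.antitranspose.IsTiling where
  box_proper := h.box_proper.antitranspose
  room_proper i hi := (h.room_proper i hi).antitranspose
  disjoint i hi j hj hij := by
    rw [Set.disjoint_left]
    rintro ⟨x, y⟩ hx hy
    exact Set.disjoint_left.1 (h.disjoint i hi j hj hij)
      (Rect.mem_openRegion_antitranspose.1 hx) (Rect.mem_openRegion_antitranspose.1 hy)
  cover := by
    ext ⟨x, y⟩
    have := Set.ext_iff.1 h.cover (-y, -x)
    simpa [Rect.mem_region_antitranspose] using this

lemma IsTiling.reflectHorizontal {f : Dissection ι} (h : f.IsTiling) :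
    f.reflectHorizontal.IsTiling where
  box_proper := h.box_proper.reflectHorizontal
  room_proper i hi := (h.room_proper i hi).reflectHorizontal
  disjoint i hi j hj hij := by
    rw [Set.disjoint_left]
    rintro ⟨x, y⟩ hx hy
    exact Set.disjoint_left.1 (h.disjoint i hi j hj hij)
      (Rect.mem_openRegion_reflectHorizontal.1 hx) (Rect.mem_openRegion_reflectHorizontal.1 hy)
  cover := by
    ext ⟨x, y⟩
    have := Set.ext_iff.1 h.cover (x, -y)
    simpa [Rect.mem_region_reflectHorizontal] using this

lemma IsMosaic.isTiling {f : Dissection ι} (h : f.IsMosaic) : f.IsTiling :=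
  ⟨h.box_proper, h.room_proper, h.disjoint, h.cover⟩

lemma IsTiling.isMosaic {f : Dissection ι} (h : f.IsTiling)
    (hc : ∀ x y, ¬ f.IsCross (x, y)) : f.IsMosaic :=
  ⟨h.box_proper, h.room_proper, h.disjoint, h.cover, fun p => hc p.1 p.2⟩

lemma IsMosaic.antitranspose {f : Dissection ι} (h : f.IsMosaic) : f.antitranspose.IsMosaic :=
  h.isTiling.antitranspose.isMosaic fun _ _ hp => h.no_cross _ (isCross_antitranspose.1 hp)

lemma IsMosaic.reflectHorizontal {f : Dissection ι} (h : f.IsMosaic) :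
    f.reflectHorizontal.IsMosaic :=
  h.isTiling.reflectHorizontal.isMosaic fun _ _ hp =>
    h.no_cross _ (isCross_reflectHorizontal.1 hp)

/-! ### Basic geometry of tilings -/

namespace IsTiling

variable {f : Dissection ι}

lemma eq_of_overlap (h : f.IsTiling) {i j : ι} (hi : i ∈ f.rooms) (hj : j ∈ f.rooms)
    (h1 : (f.room i).left < (f.room j).right) (h2 : (f.room j).left < (f.room i).right)
    (h3 : (f.room i).bottom < (f.room j).top) (h4 : (f.room j).bottom < (f.room i).top) :
    i = j := by
  by_contra hij
  obtain ⟨pi1, pi2⟩ := h.room_proper i hi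
  obtain ⟨pj1, pj2⟩ := h.room_proper j hj
  obtain ⟨x, hx1, hx2⟩ := exists_between (max_lt (lt_min pi1 h1) (lt_min h2 pj1))
  obtain ⟨y, hy1, hy2⟩ := exists_between (max_lt (lt_min pi2 h3) (lt_min h4 pj2))
  rw [max_lt_iff] at hx1 hy1
  rw [lt_min_iff] at hx2 hy2
  exact Set.disjoint_left.1 (h.disjoint i hi j hj hij)
    (Rect.mem_openRegion.2 ⟨⟨hx1.1, hx2.1⟩, hy1.1, hy2.1⟩)
    (Rect.mem_openRegion.2 ⟨⟨hx1.2, hx2.2⟩, hy1.2, hy2.2⟩)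

lemma separated (h : f.IsTiling) {i j : ι} (hi : i ∈ f.rooms) (hj : j ∈ f.rooms) (hij : i ≠ j) :
    (f.room i).right ≤ (f.room j).left ∨ (f.room j).right ≤ (f.room i).left ∨
    (f.room i).top ≤ (f.room j).bottom ∨ (f.room j).top ≤ (f.room i).bottom := by
  by_contra! hc
  exact hij (h.eq_of_overlap hi hj hc.2.1 hc.1 hc.2.2.2 hc.2.2.1)

lemma region_subset (h : f.IsTiling) {i : ι} (hi : i ∈ f.rooms) :
    (f.room i).region ⊆ f.box.region := by
  rw [← h.cover]
  exact Set.subset_biUnion_of_mem (u := fun i => (f.room i).region) hi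

lemma room_bounds (h : f.IsTiling) {i : ι} (hi : i ∈ f.rooms) :
    (f.box.left ≤ (f.room i).left ∧ (f.room i).right ≤ f.box.right) ∧
    f.box.bottom ≤ (f.room i).bottom ∧ (f.room i).top ≤ f.box.top := by
  obtain ⟨h1, h2⟩ := h.room_proper i hi
  have e1 := h.region_subset hi (Rect.mem_region.2 ⟨⟨le_rfl, h1.le⟩, le_rfl, h2.le⟩)
  have e2 := h.region_subset hi (Rect.mem_region.2 ⟨⟨h1.le, le_rfl⟩, h2.le, le_rfl⟩)
  exact ⟨⟨e1.1.1, e2.1.2⟩, e1.2.1, e2.2.2⟩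

lemma exists_mem_region (h : f.IsTiling) {x y : ℝ} (hp : (x, y) ∈ f.box.region) :
    ∃ i ∈ f.rooms, (x, y) ∈ (f.room i).region := by
  rw [← h.cover] at hp
  simpa using hp

open Filter Topology in
/-- Just to the right of and below each point lies a room. -/
lemma exists_room_SE (h : f.IsTiling) {x y : ℝ} (hx : f.box.left ≤ x) (hx' : x < f.box.right)
    (hy : f.box.bottom < y) (hy' : y ≤ f.box.top) :
    ∃ i ∈ f.rooms, ((f.room i).left ≤ x ∧ x < (f.room i).right) ∧
      (f.room i).bottom < y ∧ y ≤ (f.room i).top := by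
  have hpos : ∀ᶠ t : ℝ in 𝓝[>] 0, 0 < t := eventually_mem_nhdsWithin
  have hsmall : ∀ c : ℝ, 0 < c → ∀ᶠ t : ℝ in 𝓝[>] 0, t < c := fun c hc =>
    eventually_nhdsWithin_of_eventually_nhds (eventually_lt_nhds hc)
  have ev : ∀ᶠ t : ℝ in 𝓝[>] 0, ∃ i ∈ f.rooms, (x + t, y - t) ∈ (f.room i).region := by
    filter_upwards [hpos, hsmall _ (sub_pos.2 hx'), hsmall _ (sub_pos.2 hy)] with t h0 h1 h2
    exact h.exists_mem_region
      (Rect.mem_region.2 ⟨⟨by linarith, by linarith⟩, by linarith, by linarith⟩)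
  -- Pigeonhole: finitely many closed rooms contain all points `(x + t, y - t)` with small `t > 0`,
  -- so one of them does for arbitrarily small `t`. Letting `t` tend to `0` gives the weak
  -- inequalities, and a single `t > 0` the strict ones.
  have hnb : ∃ i ∈ f.rooms, ∃ᶠ t : ℝ in 𝓝[>] 0, (x + t, y - t) ∈ (f.room i).region := by
    by_contra! hc
    obtain ⟨t, ⟨i, hi, ht⟩, ht'⟩ := (ev.and ((eventually_all_finset f.rooms).2 hc)).exists
    exact ht' i hi ht
  obtain ⟨i, hi, hf⟩ := hnb
  obtain ⟨t, ht, h0⟩ := (hf.and_eventually hpos).exists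
  rw [Rect.mem_region] at ht
  refine ⟨i, hi, ⟨?_, by linarith [ht.1.2]⟩, by linarith [ht.2.1], ?_⟩
  · by_contra! hc
    obtain ⟨t, ht, h0⟩ := (hf.and_eventually (hsmall _ (sub_pos.2 hc))).exists
    rw [Rect.mem_region] at ht
    linarith [ht.1.1]
  · by_contra! hc
    obtain ⟨t, ht, h0⟩ := (hf.and_eventually (hsmall _ (sub_pos.2 hc))).exists
    rw [Rect.mem_region] at ht
    linarith [ht.2.2]

lemma exists_room_NE (h : f.IsTiling) {x y : ℝ} (hx : f.box.left ≤ x) (hx' : x < f.box.right)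
    (hy : f.box.bottom ≤ y) (hy' : y < f.box.top) :
    ∃ i ∈ f.rooms, ((f.room i).left ≤ x ∧ x < (f.room i).right) ∧
      (f.room i).bottom ≤ y ∧ y < (f.room i).top := by
  obtain ⟨i, hi, h1, h2, h3⟩ := h.reflectHorizontal.exists_room_SE (x := x) (y := -y) hx hx'
    (neg_lt_neg hy') (neg_le_neg hy)
  exact ⟨i, hi, h1, neg_le_neg_iff.1 h3, neg_lt_neg_iff.1 h2⟩

lemma exists_room_SW (h : f.IsTiling) {x y : ℝ} (hx : f.box.left < x) (hx' : x ≤ f.box.right)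
    (hy : f.box.bottom < y) (hy' : y ≤ f.box.top) :
    ∃ i ∈ f.rooms, ((f.room i).left < x ∧ x ≤ (f.room i).right) ∧
      (f.room i).bottom < y ∧ y ≤ (f.room i).top := by
  obtain ⟨i, hi, ⟨h1, h2⟩, h3, h4⟩ := h.antitranspose.exists_room_NE (x := -y) (y := -x)
    (neg_le_neg hy') (neg_lt_neg hy) (neg_le_neg hx') (neg_lt_neg hx)
  exact ⟨i, hi, ⟨neg_lt_neg_iff.1 h4, neg_le_neg_iff.1 h3⟩, neg_lt_neg_iff.1 h2,
    neg_le_neg_iff.1 h1⟩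

/-- The walls are the points of the bounding rectangle which are not inside a room. -/
lemma mem_walls_iff (h : f.IsTiling) {x y : ℝ} : (x, y) ∈ f.walls ↔
    (x, y) ∈ f.box.region ∧ ∀ i ∈ f.rooms, (x, y) ∉ (f.room i).openRegion := by
  rw [mem_walls]
  constructor
  · rintro ⟨i, hi, hw⟩
    obtain ⟨p1, p2⟩ := h.room_proper i hi
    refine ⟨h.region_subset hi (Rect.mem_region.2 ?_), fun j hj hm => ?_⟩
    · rcases hw with ⟨rfl | rfl, h1, h2⟩ | ⟨rfl | rfl, h1, h2⟩ <;>
        refine ⟨⟨?_, ?_⟩, ?_, ?_⟩ <;> linarith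
    · obtain ⟨⟨m1, m2⟩, m3, m4⟩ := Rect.mem_openRegion.1 hm
      have : i = j := by
        apply h.eq_of_overlap hi hj <;>
          rcases hw with ⟨rfl | rfl, h1, h2⟩ | ⟨rfl | rfl, h1, h2⟩ <;> linarith
      subst this
      rcases hw with ⟨rfl | rfl, h1, h2⟩ | ⟨rfl | rfl, h1, h2⟩ <;> linarith
  · rintro ⟨hb, hn⟩
    obtain ⟨i, hi, hm⟩ := h.exists_mem_region hb
    refine ⟨i, hi, ?_⟩
    have := hn i hi
    rw [Rect.mem_openRegion] at this
    obtain ⟨⟨m1, m2⟩, m3, m4⟩ := Rect.mem_region.1 hm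
    by_contra! hc
    refine this ⟨⟨lt_of_le_of_ne m1 fun e => ?_, lt_of_le_of_ne m2 fun e => ?_⟩,
      lt_of_le_of_ne m3 fun e => ?_, lt_of_le_of_ne m4 fun e => ?_⟩
    · linarith [hc.1 (.inl e.symm) m3]
    · linarith [hc.1 (.inr e) m3]
    · linarith [hc.2 (.inl e.symm) m1]
    · linarith [hc.2 (.inr e) m1]

-- Translates arms into inequalities between room coordinates: an arm to the right is blocked
-- exactly by a room whose interior contains the points just to the right of `(x, y)`.
open Filter Topology in
lemma hasArm_right_iff (h : f.IsTiling) {x y : ℝ} : f.HasArm (x, y) (1, 0) ↔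
    (x, y) ∈ f.box.region ∧ x < f.box.right ∧
      ∀ i ∈ f.rooms, (f.room i).left ≤ x → x < (f.room i).right →
        (f.room i).bottom < y → (f.room i).top ≤ y := by
  simp only [HasArm, Prod.smul_mk, Prod.mk_add_mk, smul_eq_mul, mul_one, mul_zero, add_zero,
    h.mem_walls_iff]
  constructor
  · rintro ⟨ε, hε, H⟩
    have H0 := (H 0 le_rfl hε.le).1
    have Hε := (H ε hε.le le_rfl).1
    rw [add_zero] at H0
    refine ⟨H0, by linarith [(Rect.mem_region.1 Hε).1.2], fun i hi h1 h2 h3 => ?_⟩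
    by_contra! h4
    obtain ⟨t, t0, t1⟩ := exists_between (lt_min hε (sub_pos.2 h2))
    rw [lt_min_iff] at t1
    exact (H t t0.le t1.1.le).2 i hi
      (Rect.mem_openRegion.2 ⟨⟨by linarith, by linarith⟩, h3, h4⟩)
  · rintro ⟨hb, hx, H⟩
    rw [Rect.mem_region] at hb
    -- The arm is kept shorter than the distance to every left edge strictly to the right, so a room
    -- met by it already starts at or before `x`.
    have ev : ∀ i ∈ f.rooms, ∀ᶠ t : ℝ in 𝓝[>] 0, x < (f.room i).left → x + t < (f.room i).left := by
      intro i hi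
      by_cases hc : x < (f.room i).left
      · filter_upwards [eventually_nhdsWithin_of_eventually_nhds
          (eventually_lt_nhds (sub_pos.2 hc))] with t ht _
        linarith
      · exact Eventually.of_forall fun t ht => absurd ht hc
    have hpos : ∀ᶠ t : ℝ in 𝓝[>] 0, 0 < t := eventually_mem_nhdsWithin
    obtain ⟨ε, ⟨h1, h2⟩, h3⟩ := (((eventually_all_finset f.rooms).2 ev).and hpos |>.and
      (eventually_nhdsWithin_of_eventually_nhds (eventually_lt_nhds (sub_pos.2 hx)))).exists
    refine ⟨ε, h2, fun t t0 t1 => ⟨Rect.mem_region.2 ⟨⟨by linarith, by linarith⟩, hb.2⟩, ?_⟩⟩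
    intro i hi hm
    obtain ⟨⟨m1, m2⟩, m3, m4⟩ := Rect.mem_openRegion.1 hm
    rcases lt_or_ge x (f.room i).left with hc | hc
    · linarith [h1 i hi hc]
    · linarith [H i hi hc (by linarith) m3]

/-- The two reflections permute the four directions transitively, so the analysis of the rightward
arm suffices. -/
lemma hasArm_down_iff (h : f.IsTiling) {x y : ℝ} : f.HasArm (x, y) (0, -1) ↔
    (x, y) ∈ f.box.region ∧ f.box.bottom < y ∧
      ∀ i ∈ f.rooms, y ≤ (f.room i).top → (f.room i).bottom < y →
        (f.room i).left < x → (f.room i).right ≤ x := by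
  have := hasArm_antitranspose (f := f) (x := -y) (y := -x) (u := 1) (v := 0)
  rw [neg_neg, neg_neg, neg_zero] at this
  rw [← this, h.antitranspose.hasArm_right_iff]
  simp only [antitranspose_box, antitranspose_rooms, antitranspose_room,
    Rect.mem_region_antitranspose, neg_neg]
  simp only [Rect.antitranspose, neg_le_neg_iff, neg_lt_neg_iff]
  grind

lemma hasArm_up_iff (h : f.IsTiling) {x y : ℝ} : f.HasArm (x, y) (0, 1) ↔
    (x, y) ∈ f.box.region ∧ y < f.box.top ∧
      ∀ i ∈ f.rooms, (f.room i).bottom ≤ y → y < (f.room i).top →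
        (f.room i).left < x → (f.room i).right ≤ x := by
  have := hasArm_reflectHorizontal (f := f) (x := x) (y := -y) (u := 0) (v := -1)
  rw [neg_neg, neg_neg] at this
  rw [← this, h.reflectHorizontal.hasArm_down_iff]
  simp only [reflectHorizontal_box, reflectHorizontal_rooms, reflectHorizontal_room,
    Rect.mem_region_reflectHorizontal, neg_neg]
  simp only [Rect.reflectHorizontal, neg_le_neg_iff, neg_lt_neg_iff]

lemma hasArm_left_iff (h : f.IsTiling) {x y : ℝ} : f.HasArm (x, y) (-1, 0) ↔
    (x, y) ∈ f.box.region ∧ f.box.left < x ∧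
      ∀ i ∈ f.rooms, (f.room i).left < x → x ≤ (f.room i).right →
        (f.room i).bottom < y → (f.room i).top ≤ y := by
  have := hasArm_antitranspose (f := f) (x := -y) (y := -x) (u := 0) (v := 1)
  rw [neg_neg, neg_neg, neg_zero] at this
  rw [← this, h.antitranspose.hasArm_up_iff]
  simp only [antitranspose_box, antitranspose_rooms, antitranspose_room,
    Rect.mem_region_antitranspose, neg_neg]
  simp only [Rect.antitranspose, neg_le_neg_iff, neg_lt_neg_iff]
  grind

end IsTiling

end Dissection

namespace Dissection

variable {ι κ : Type*}

/-! ### The relations between rooms on a common segment -/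

/-- No room extends to both sides of the vertical segment from `(x, c)` to `(x, d)`. -/
def VFree (f : Dissection ι) (x c d : ℝ) : Prop :=
  ∀ i ∈ f.rooms, (f.room i).left < x → x < (f.room i).right →
    (f.room i).bottom < d → (f.room i).top ≤ c

/-- No room extends to both sides of the horizontal segment from `(c, y)` to `(d, y)`. -/
def HFree (f : Dissection ι) (y c d : ℝ) : Prop :=
  ∀ i ∈ f.rooms, (f.room i).bottom < y → y < (f.room i).top →
    (f.room i).left < d → (f.room i).right ≤ c

/-- The right edge of `a` and the left edge of `b` lie on a common vertical segment. -/
def LeftOf (f : Dissection ι) (a b : ι) : Prop :=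
  a ∈ f.rooms ∧ b ∈ f.rooms ∧ (f.room a).right = (f.room b).left ∧
    f.VFree (f.room a).right (min (f.room a).bottom (f.room b).bottom)
      (max (f.room a).top (f.room b).top)

/-- The bottom edge of `a` and the top edge of `b` lie on a common horizontal segment. -/
def Above (f : Dissection ι) (a b : ι) : Prop :=
  a ∈ f.rooms ∧ b ∈ f.rooms ∧ (f.room a).bottom = (f.room b).top ∧
    f.HFree (f.room a).bottom (min (f.room a).left (f.room b).left)
      (max (f.room a).right (f.room b).right)

variable {f : Dissection ι}

lemma vFree_antitranspose {x c d : ℝ} : f.antitranspose.VFree x c d ↔ f.HFree (-x) (-d) (-c) := by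
  simp only [HFree, VFree, antitranspose_rooms, antitranspose_room, Rect.antitranspose]
  refine forall₂_congr fun i _ => ?_
  constructor <;> intro h h1 h2 h3 <;> by_contra! h4 <;>
    linarith [h (by linarith) (by linarith) (by linarith)]

lemma vFree_reflectHorizontal {x c d : ℝ} :
    f.reflectHorizontal.VFree x c d ↔ f.VFree x (-d) (-c) := by
  simp only [VFree, reflectHorizontal_rooms, reflectHorizontal_room, Rect.reflectHorizontal]
  refine forall₂_congr fun i _ => ?_
  constructor <;> intro h h1 h2 h3 <;> by_contra! h4 <;>
    linarith [h (by linarith) (by linarith) (by linarith)]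

lemma hFree_reflectHorizontal {y c d : ℝ} :
    f.reflectHorizontal.HFree y c d ↔ f.HFree (-y) c d := by
  simp only [HFree, reflectHorizontal_rooms, reflectHorizontal_room, Rect.reflectHorizontal]
  refine forall₂_congr fun i _ => ?_
  constructor <;> intro h h1 h2 h3 <;> by_contra! h4 <;>
    linarith [h (by linarith) (by linarith) (by linarith)]

/-- This exchange is what leaves the top-left order fixed and reverses the bottom-left one. -/
lemma leftOf_antitranspose {a b : ι} : f.antitranspose.LeftOf a b ↔ f.Above a b := by
  simp only [LeftOf, Above, vFree_antitranspose, antitranspose_rooms, antitranspose_room,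
    Rect.antitranspose, neg_inj, min_neg_neg, max_neg_neg, neg_neg]

lemma above_antitranspose {a b : ι} : f.antitranspose.Above a b ↔ f.LeftOf a b := by
  rw [← leftOf_antitranspose, antitranspose_antitranspose]

lemma leftOf_reflectHorizontal {a b : ι} : f.reflectHorizontal.LeftOf a b ↔ f.LeftOf a b := by
  simp only [LeftOf, vFree_reflectHorizontal, reflectHorizontal_rooms, reflectHorizontal_room,
    Rect.reflectHorizontal, min_neg_neg, max_neg_neg, neg_neg]

lemma above_reflectHorizontal {a b : ι} : f.reflectHorizontal.Above a b ↔ f.Above b a := by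
  simp only [Above, hFree_reflectHorizontal, reflectHorizontal_rooms, reflectHorizontal_room,
    Rect.reflectHorizontal, neg_inj, neg_neg]
  constructor
  · rintro ⟨h1, h2, h3, h4⟩
    exact ⟨h2, h1, h3.symm, by rwa [min_comm, max_comm, ← h3]⟩
  · rintro ⟨h1, h2, h3, h4⟩
    exact ⟨h2, h1, h3.symm, by rwa [min_comm, max_comm, ← h3]⟩

/-! ### Top-left block deletion -/

/-- The room `b` at the top left corner ends below in a horizontal edge which ends at a vertical
segment passing through its right end. -/
structure HasLeftTeeCorner (f : Dissection ι) (b : ι) : Prop where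
  mem : b ∈ f.rooms
  left : (f.room b).left = f.box.left
  top : (f.room b).top = f.box.top
  bottom : f.box.bottom < (f.room b).bottom
  no_right : f.box.right ≤ (f.room b).right ∨ ∃ j ∈ f.rooms,
    ((f.room j).left ≤ (f.room b).right ∧ (f.room b).right < (f.room j).right) ∧
    (f.room j).bottom < (f.room b).bottom ∧ (f.room b).bottom < (f.room j).top
  down : ∀ i ∈ f.rooms, (f.room b).bottom ≤ (f.room i).top → (f.room i).bottom < (f.room b).bottom →
    (f.room i).left < (f.room b).right → (f.room i).right ≤ (f.room b).right

/-- Only the missing right arm and the present downward arm carry information; the other two arms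
hold for every room in the corner. -/
lemma IsTiling.hasLeftTeeCorner (h : f.IsTiling) {b : ι} (hb : f.IsTopLeftRoom b)
    (ht : f.IsLeftTee ((f.room b).right, (f.room b).bottom)) : f.HasLeftTeeCorner b := by
  obtain ⟨h1, -, -, h4⟩ := ht
  rw [h.hasArm_right_iff] at h1
  rw [h.hasArm_down_iff] at h4
  refine ⟨hb.1, hb.2.1, hb.2.2, h4.2.1, ?_, h4.2.2⟩
  by_contra! hc
  refine h1 ⟨h4.1, hc.1, fun i hi h2 h3 h4 => ?_⟩
  exact hc.2 i hi ⟨h2, h3⟩ h4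

namespace HasLeftTeeCorner

variable {b : ι}

/-- Since `b` fills the corner, a room starting left of its right end and reaching above its bottom
edge would overlap it. -/
lemma top_le (hb : f.HasLeftTeeCorner b) (h : f.IsTiling) {i : ι} (hi : i ∈ f.rooms) (hib : i ≠ b)
    (hl : (f.room i).left < (f.room b).right) : (f.room i).top ≤ (f.room b).bottom := by
  by_contra! hc
  have hr := h.room_bounds hi
  have hp := h.room_proper i hi
  refine hib (h.eq_of_overlap hi hb.mem hl ?_ ?_ hc)
  · rw [hb.left]; linarith [hp.1]
  · rw [hb.top]; linarith [hp.2]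

lemma exists_below (hb : f.HasLeftTeeCorner b) (h : f.IsTiling) {x : ℝ} (hx : f.box.left ≤ x)
    (hx' : x < (f.room b).right) : ∃ i ∈ f.rooms, i ≠ b ∧
      (f.room i).top = (f.room b).bottom ∧ (f.room i).left ≤ x ∧ x < (f.room i).right := by
  have hr := h.room_bounds hb.mem
  have hp := h.room_proper b hb.mem
  obtain ⟨i, hi, h1, h2⟩ := h.exists_room_SE hx (by linarith) hb.bottom (by linarith [hp.2])
  have hib : i ≠ b := by rintro rfl; linarith
  exact ⟨i, hi, hib, le_antisymm (hb.top_le h hi hib (by linarith)) h2.2, h1⟩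

lemma exists_below' (hb : f.HasLeftTeeCorner b) (h : f.IsTiling) {x : ℝ} (hx : f.box.left < x)
    (hx' : x ≤ (f.room b).right) : ∃ i ∈ f.rooms, i ≠ b ∧
      (f.room i).top = (f.room b).bottom ∧ (f.room i).left < x ∧ x ≤ (f.room i).right := by
  have hr := h.room_bounds hb.mem
  have hp := h.room_proper b hb.mem
  obtain ⟨i, hi, h1, h2⟩ := h.exists_room_SW hx (by linarith) hb.bottom (by linarith [hp.2])
  have hib : i ≠ b := by rintro rfl; linarith
  exact ⟨i, hi, hib, le_antisymm (hb.top_le h hi hib (by linarith)) h2.2, h1⟩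

end HasLeftTeeCorner

/-! ### Effect of a deletion on the tiling, the junctions and the relations -/

variable [DecidableEq ι]

@[simp] lemma shiftBottomUp_box (f : Dissection ι) (b : ι) : (f.shiftBottomUp b).box = f.box := rfl

@[simp] lemma shiftBottomUp_rooms (f : Dissection ι) (b : ι) :
    (f.shiftBottomUp b).rooms = f.rooms.erase b := rfl

@[simp] lemma shiftBottomUp_left (f : Dissection ι) (b i : ι) :
    ((f.shiftBottomUp b).room i).left = (f.room i).left := by
  simp only [shiftBottomUp]; split_ifs <;> rfl

@[simp] lemma shiftBottomUp_right (f : Dissection ι) (b i : ι) :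
    ((f.shiftBottomUp b).room i).right = (f.room i).right := by
  simp only [shiftBottomUp]; split_ifs <;> rfl

@[simp] lemma shiftBottomUp_bottom (f : Dissection ι) (b i : ι) :
    ((f.shiftBottomUp b).room i).bottom = (f.room i).bottom := by
  simp only [shiftBottomUp]; split_ifs <;> rfl

namespace HasLeftTeeCorner

variable {b : ι}

/-- The effect of the deletion on the tops of the rooms. -/
lemma shiftBottomUp_top (hb : f.HasLeftTeeCorner b) (h : f.IsTiling) {i : ι} (hi : i ∈ f.rooms)
    (hib : i ≠ b) :
    ((f.room i).top = (f.room b).bottom ∧ (f.room i).left < (f.room b).right ∧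
      (f.room i).right ≤ (f.room b).right ∧ ((f.shiftBottomUp b).room i).top = f.box.top) ∨
    ((f.room b).right ≤ (f.room i).left ∨ (f.room i).top < (f.room b).bottom) ∧
      ((f.shiftBottomUp b).room i).top = (f.room i).top := by
  have hp := h.room_proper i hi
  have hr := h.room_bounds hi
  simp only [shiftBottomUp]
  split_ifs with hc
  · exact .inl ⟨hc.1, hp.1.trans_le hc.2.2, hc.2.2, hb.top⟩
  · refine .inr ⟨?_, rfl⟩
    -- Otherwise the room touches the bottom edge of `b`, and `down` keeps it from sticking out past
    -- the right end, so the room would be prolonged.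
    by_contra! h1
    have h2 := hb.top_le h hi hib h1.1
    refine hc ⟨le_antisymm h2 h1.2, hb.left.trans_le hr.1.1, ?_⟩
    exact hb.down i hi h1.2 (by linarith [hp.2]) h1.1

lemma top_le_shiftBottomUp_top (hb : f.HasLeftTeeCorner b) (h : f.IsTiling) {i : ι}
    (hi : i ∈ f.rooms) (hib : i ≠ b) :
    (f.room i).top ≤ ((f.shiftBottomUp b).room i).top := by
  have hr := h.room_bounds hi
  rcases hb.shiftBottomUp_top h hi hib with ⟨-, -, -, h1⟩ | ⟨-, h1⟩ <;> linarith

lemma shiftBottomUp_isTiling (hb : f.HasLeftTeeCorner b) (h : f.IsTiling) :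
    (f.shiftBottomUp b).IsTiling where
  box_proper := h.box_proper
  room_proper i hi := by
    obtain ⟨hib, hi⟩ := Finset.mem_erase.1 hi
    have := h.room_proper i hi
    exact ⟨by simpa using this.1,
      by simpa using this.2.trans_le (hb.top_le_shiftBottomUp_top h hi hib)⟩
  disjoint i hi j hj hij := by
    obtain ⟨hib, hi⟩ := Finset.mem_erase.1 hi
    obtain ⟨hjb, hj⟩ := Finset.mem_erase.1 hj
    rw [Set.disjoint_left]
    rintro ⟨x, y⟩ hx hy
    rw [Rect.mem_openRegion] at hx hy
    simp only [shiftBottomUp_left, shiftBottomUp_right, shiftBottomUp_bottom] at hx hy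
    have hpi := h.room_proper i hi
    have hpj := h.room_proper j hj
    have hs := h.separated hi hj hij
    have hbi := h.room_bounds hi
    have hbj := h.room_bounds hj
    -- Two prolonged rooms have the same old top, so they are separated horizontally. A room that is
    -- not prolonged is to the right of `b` or ends below its bottom edge, out of the way of the new
    -- area.
    rcases hb.shiftBottomUp_top h hi hib with ⟨h1, h2, h3, h4⟩ | ⟨h1, h4⟩ <;>
    rcases hb.shiftBottomUp_top h hj hjb with ⟨g1, g2, g3, g4⟩ | ⟨g1, g4⟩ <;>
    obtain ⟨hpi1, hpi2⟩ := hpi <;> obtain ⟨hpj1, hpj2⟩ := hpj <;> grind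
  cover := by
    ext ⟨x, y⟩
    simp only [Set.mem_iUnion, exists_prop, shiftBottomUp_box, shiftBottomUp_rooms,
      Finset.mem_erase, Rect.mem_region, shiftBottomUp_left, shiftBottomUp_right,
      shiftBottomUp_bottom]
    constructor
    · rintro ⟨i, ⟨hib, hi⟩, h1, h2⟩
      have hbi := h.room_bounds hi
      refine ⟨⟨by linarith, by linarith⟩, by linarith, ?_⟩
      rcases hb.shiftBottomUp_top h hi hib with ⟨-, -, -, h4⟩ | ⟨-, h4⟩ <;> linarith
    · intro hp
      obtain ⟨i, hi, hm⟩ := h.exists_mem_region (Rect.mem_region.2 hp)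
      rw [Rect.mem_region] at hm
      by_cases hib : i = b
      · subst hib
        have hpb := h.room_proper i hb.mem
        have : ∃ j ∈ f.rooms, j ≠ i ∧ (f.room j).top = (f.room i).bottom ∧
            (f.room j).left < (f.room i).right ∧ (f.room j).left ≤ x ∧ x ≤ (f.room j).right := by
          rcases hm.1.2.lt_or_eq with hx | hx
          · obtain ⟨j, hj, hji, h1, h2, h3⟩ := hb.exists_below h hp.1.1 hx
            exact ⟨j, hj, hji, h1, by linarith, h2, h3.le⟩
          · obtain ⟨j, hj, hji, h1, h2, h3⟩ := hb.exists_below' h (x := x)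
              (by rw [hx, ← hb.left]; exact hpb.1) hx.le
            exact ⟨j, hj, hji, h1, by linarith, h2.le, h3⟩
        obtain ⟨j, hj, hji, h1, h2, h3⟩ := this
        have hpj := h.room_proper j hj
        refine ⟨j, ⟨hji, hj⟩, h3, by linarith [hpj.2], ?_⟩
        rcases hb.shiftBottomUp_top h hj hji with ⟨-, -, -, h4⟩ | ⟨h4, -⟩
        · rw [h4]; exact hp.2.2
        · rcases h4 with h4 | h4 <;> linarith
      · exact ⟨i, ⟨hib, hi⟩, hm.1, hm.2.1,
          hm.2.2.trans (hb.top_le_shiftBottomUp_top h hi hib)⟩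

/-- The surviving rooms only grow, so outside the area of `b` every arm of the new floorplan is an
arm of the old one; a new cross there would be an old cross. -/
lemma shiftBottomUp_isMosaic (hb : f.HasLeftTeeCorner b) (h : f.IsMosaic) :
    (f.shiftBottomUp b).IsMosaic := by
  have ht := h.isTiling
  have ht' := hb.shiftBottomUp_isTiling ht
  refine ht'.isMosaic fun x y hc => h.no_cross (x, y) ?_
  simp only [IsCross, ht'.hasArm_right_iff, ht'.hasArm_left_iff, ht'.hasArm_up_iff,
    ht'.hasArm_down_iff, ht.hasArm_right_iff, ht.hasArm_left_iff, ht.hasArm_up_iff,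
    ht.hasArm_down_iff, shiftBottomUp_rooms, shiftBottomUp_left, shiftBottomUp_right,
    shiftBottomUp_bottom, shiftBottomUp_box] at hc ⊢
  obtain ⟨⟨hm, hx1, hR⟩, ⟨-, hx2, hL⟩, ⟨-, hy1, hU⟩, ⟨-, hy2, hD⟩⟩ := hc
  -- In the area of `b`, the prolonged room just left of the point reaches the top of the box and
  -- blocks the left arm.
  have key : (f.room b).right < x ∨ y < (f.room b).bottom := by
    by_contra! hk
    obtain ⟨i, hi, hib, h1, h2, h3⟩ := hb.exists_below' ht hx2 hk.1
    have hp := ht.room_proper i hi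
    have := hL i (Finset.mem_erase.2 ⟨hib, hi⟩) h2 h3 (by linarith [hp.2])
    rcases hb.shiftBottomUp_top ht hi hib with ⟨-, -, -, h4⟩ | ⟨h4, -⟩
    · linarith
    · rcases h4 with h4 | h4 <;> linarith
  refine ⟨⟨hm, hx1, fun i hi h1 h2 h3 => ?_⟩, ⟨hm, hx2, fun i hi h1 h2 h3 => ?_⟩,
    ⟨hm, hy1, fun i hi h1 h2 h3 => ?_⟩, ⟨hm, hy2, fun i hi h1 h2 h3 => ?_⟩⟩
  all_goals
    by_cases hib : i = b
    · subst hib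
      rcases key with key | key <;> linarith
    · have hie := Finset.mem_erase.2 ⟨hib, hi⟩
      have hle := hb.top_le_shiftBottomUp_top ht hi hib
      first
      | exact hle.trans (hR i hie h1 h2 h3)
      | exact hle.trans (hL i hie h1 h2 h3)
      | exact hU i hie h1 (h2.trans_le hle) h3
      | exact hD i hie (h1.trans hle) h2 h3

/-- If the common abscissa is inside the width of `b`, both rooms lie below the bottom edge of `b`,
so `b` does not interfere. A prolonged room crossing this abscissa can only lie above both, and then
neither of them is prolonged. -/
lemma leftOf_shiftBottomUp (hb : f.HasLeftTeeCorner b) (h : f.IsTiling) {a c : ι}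
    (ha : a ≠ b) (hc : c ≠ b) : (f.shiftBottomUp b).LeftOf a c ↔ f.LeftOf a c := by
  simp only [LeftOf, shiftBottomUp_rooms, Finset.mem_erase, shiftBottomUp_left,
    shiftBottomUp_right, shiftBottomUp_bottom, ne_eq, ha, hc, not_false_eq_true, true_and]
  refine and_congr_right fun ham => and_congr_right fun hcm => and_congr_right fun hac => ?_
  simp only [VFree, shiftBottomUp_rooms, Finset.mem_erase, shiftBottomUp_left,
    shiftBottomUp_right, shiftBottomUp_bottom, lt_max_iff, le_min_iff]
  obtain ⟨hpa1, hpa2⟩ := h.room_proper a ham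
  obtain ⟨hpc1, hpc2⟩ := h.room_proper c hcm
  have hab := h.room_bounds ham
  have hcb := h.room_bounds hcm
  have hta := hb.top_le_shiftBottomUp_top h ham ha
  have htc := hb.top_le_shiftBottomUp_top h hcm hc
  have hla := hb.top_le h ham ha
  have hlc := hb.top_le h hcm hc
  have hca := hb.shiftBottomUp_top h ham ha
  have hcc := hb.shiftBottomUp_top h hcm hc
  constructor
  · intro H i hi h1 h2 h3
    by_cases hib : i = b
    · subst hib
      have := hb.left
      have := hb.top
      grind
    · have hti := hb.top_le_shiftBottomUp_top h hi hib
      have := H i ⟨hib, hi⟩ h1 h2 (by grind)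
      exact ⟨hti.trans this.1, hti.trans this.2⟩
  · rintro H i ⟨hib, hi⟩ h1 h2 h3
    obtain ⟨hpi1, hpi2⟩ := h.room_proper i hi
    have hti := hb.shiftBottomUp_top h hi hib
    have hli := hb.top_le h hi hib
    have := H i hi h1 h2
    grind

lemma above_shiftBottomUp (hb : f.HasLeftTeeCorner b) (h : f.IsTiling) {a c : ι}
    (ha : a ≠ b) (hc : c ≠ b) : (f.shiftBottomUp b).Above a c ↔ f.Above a c := by
  simp only [Above, shiftBottomUp_rooms, Finset.mem_erase, shiftBottomUp_left,
    shiftBottomUp_right, shiftBottomUp_bottom, ne_eq, ha, hc, not_false_eq_true, true_and]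
  refine and_congr_right fun ham => and_congr_right fun hcm => ?_
  simp only [HFree, shiftBottomUp_rooms, Finset.mem_erase, shiftBottomUp_left,
    shiftBottomUp_right, shiftBottomUp_bottom, lt_max_iff, le_min_iff]
  obtain ⟨hpa1, hpa2⟩ := h.room_proper a ham
  obtain ⟨hpc1, hpc2⟩ := h.room_proper c hcm
  obtain ⟨hpb1, hpb2⟩ := h.room_proper b hb.mem
  have hbb := h.room_bounds hb.mem
  have hab := h.room_bounds ham
  have hcb := h.room_bounds hcm
  have hla := hb.top_le h ham ha
  have hlc := hb.top_le h hcm hc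
  have hl := hb.left
  have ht := hb.top
  constructor
  · rintro ⟨H1, H⟩
    rcases hb.shiftBottomUp_top h hcm hc with ⟨g1, g2, g3, g4⟩ | ⟨g1, g4⟩
    · linarith
    rw [g4] at H1
    refine ⟨H1, fun i hi h1 h2 h3 => ?_⟩
    by_cases hib : i = b
    · subst hib
      by_contra! hcon
      have hmin : min (f.room a).left (f.room c).left < (f.room i).right := by
        rw [min_lt_iff]
        by_contra! h4
        exact absurd (hcon h4.1) (not_lt.2 h4.2)
      -- The room hanging below `b` at the left end of the horizontal stretch, once prolonged, would
      -- cut this stretch.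
      obtain ⟨j, hj, hji, k1, k2, k3⟩ := hb.exists_below h (le_min hab.1.1 hcb.1.1) hmin
      have hpj := h.room_proper j hj
      have := H j ⟨hji, hj⟩ (by linarith [hpj.2])
      rcases hb.shiftBottomUp_top h hj hji with ⟨-, -, -, h4⟩ | ⟨h4, -⟩
      · rcases le_total (f.room a).left (f.room c).left with hle | hle <;>
          [rw [min_eq_left hle] at k2 k3; rw [min_eq_right hle] at k2 k3] <;> grind
      · grind
    · exact H i ⟨hib, hi⟩ h1 (h2.trans_le (hb.top_le_shiftBottomUp_top h hi hib)) h3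
  · rintro ⟨H1, H⟩
    -- If `c` hung from the bottom edge of `b`, then `a`, resting on the same segment, would start
    -- at or beyond the right end of `b`. The segment would pass the corner, against `no_right`.
    have hcl : (f.room b).right ≤ (f.room c).left ∨ (f.room c).top < (f.room b).bottom := by
      by_contra! hcon
      have e := le_antisymm (hlc hcon.1) hcon.2
      have har : (f.room b).right ≤ (f.room a).left := by
        by_contra! h1
        linarith [hla h1]
      rcases hb.no_right with hr | ⟨j, hj, hj1, hj2⟩
      · linarith
      · have := H j hj
        grind
    have hct : ((f.shiftBottomUp b).room c).top = (f.room c).top := by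
      rcases hb.shiftBottomUp_top h hcm hc with ⟨g1, g2, -, -⟩ | ⟨-, g4⟩
      · grind
      · exact g4
    rw [hct]
    refine ⟨H1, ?_⟩
    rintro i ⟨hib, hi⟩ h1 h2 h3
    obtain ⟨hpi1, hpi2⟩ := h.room_proper i hi
    have hib' := h.room_bounds hi
    have Hi := H i hi h1
    have Hb := H b hb.mem
    -- A prolonged room crosses a height below the bottom edge of `b` only if it did so before. At
    -- any other height, both `a` and `c` start at or beyond the right end of `b`.
    rcases hb.shiftBottomUp_top h hi hib with ⟨g1, g2, g3, g4⟩ | ⟨g1, g4⟩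
    · have hdown := hb.down c hcm
      grind
    · exact Hi (g4 ▸ h2) h3

end HasLeftTeeCorner

end Dissection

namespace Dissection

variable {ι κ : Type*} {f f' : Dissection ι} {a b c : ι}

lemma IsTiling.exists_topLeftRoom (h : f.IsTiling) : ∃ b, f.IsTopLeftRoom b := by
  obtain ⟨i, hi, h1, h2⟩ := h.exists_room_SE le_rfl h.box_proper.1 h.box_proper.2 le_rfl
  have hb := h.room_bounds hi
  exact ⟨i, hi, le_antisymm h1.1 hb.1.1, le_antisymm hb.2.2 h2.2⟩

lemma IsTopLeftRoom.antitranspose (hb : f.IsTopLeftRoom b) : f.antitranspose.IsTopLeftRoom b :=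
  ⟨hb.1, congrArg Neg.neg hb.2.2, congrArg Neg.neg hb.2.1⟩

/-- Without cross junctions, the lower right corner of the room at the top left corner is a
`⊣`-junction or a `⊥`-junction. -/
lemma IsMosaic.isTee_of_isTopLeftRoom (h : f.IsMosaic) (hb : f.IsTopLeftRoom b)
    (hc : c ∈ f.rooms) (hcb : c ≠ b) :
    f.IsLeftTee ((f.room b).right, (f.room b).bottom) ∨
      f.IsUpTee ((f.room b).right, (f.room b).bottom) := by
  obtain ⟨hbm, hbl, hbt⟩ := hb
  have ht := h.isTiling
  obtain ⟨hp1, hp2⟩ := ht.room_proper b hbm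
  obtain ⟨⟨b1, b2⟩, b3, b4⟩ := ht.room_bounds hbm
  have hover : ∀ i ∈ f.rooms, (f.room i).left < (f.room b).right →
      (f.room b).bottom < (f.room i).top → i = b := by
    intro i hi h1 h2
    have := ht.room_bounds hi
    have := ht.room_proper i hi
    exact ht.eq_of_overlap hi hbm h1 (by linarith [this.1]) (by linarith [this.2]) h2
  have hmem : ((f.room b).right, (f.room b).bottom) ∈ f.box.region :=
    Rect.mem_region.2 ⟨⟨by linarith, b2⟩, b3, by linarith⟩
  have hL : f.HasArm ((f.room b).right, (f.room b).bottom) (-1, 0) := by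
    refine ht.hasArm_left_iff.2 ⟨hmem, by linarith, fun i hi h1 h2 h3 => ?_⟩
    by_contra! h4
    rw [hover i hi h1 h4] at h3
    exact lt_irrefl _ h3
  have hU : f.HasArm ((f.room b).right, (f.room b).bottom) (0, 1) := by
    refine ht.hasArm_up_iff.2 ⟨hmem, by linarith, fun i hi h1 h2 h3 => ?_⟩
    rw [hover i hi h3 h2]
  -- Rooms blocking the right and the downward arm would coincide and overlap `b`. If the corner is
  -- on one side of the box, a blocker would leave the box; if it is the lower right corner of the
  -- box, `b` is the whole box.
  have hor : f.HasArm ((f.room b).right, (f.room b).bottom) (1, 0) ∨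
      f.HasArm ((f.room b).right, (f.room b).bottom) (0, -1) := by
    by_contra! hn
    rw [ht.hasArm_right_iff, ht.hasArm_down_iff] at hn
    simp only [hmem, true_and] at hn
    push Not at hn
    obtain ⟨hn1, hn2⟩ := hn
    have hcB := ht.room_bounds hc
    have hcP := ht.room_proper c hc
    rcases b2.lt_or_eq with hr | hr
    · obtain ⟨j, hj, j1, j2, j3, j4⟩ := hn1 hr
      obtain ⟨k, hk, k1, k2, k3, k4⟩ := hn2 (by linarith [(ht.room_bounds hj).2.1])
      have : j = k := ht.eq_of_overlap hj hk (by linarith) (by linarith) (by linarith) (by linarith)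
      subst this
      rw [hover j hj k3 j4] at j3
      exact lt_irrefl _ j3
    · rcases b3.lt_or_eq with hβ | hβ
      · obtain ⟨k, hk, k1, k2, k3, k4⟩ := hn2 hβ
        linarith [(ht.room_bounds hk).1.2]
      · exact hcb (hover c hc (by linarith [hcP.1]) (by linarith [hcP.2]))
  have hx := h.no_cross ((f.room b).right, (f.room b).bottom)
  simp only [IsCross, IsLeftTee, IsUpTee] at hx ⊢
  tauto

/-! ### Any two rooms are comparable -/

/-- One of the rooms is to the left of the other one, or above it. -/
def Comparable (f : Dissection ι) (a b : ι) : Prop :=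
  (Relation.TransGen f.LeftOf a b ∨ Relation.TransGen f.LeftOf b a) ∨
  (Relation.TransGen f.Above a b ∨ Relation.TransGen f.Above b a)

lemma comparable_antitranspose : f.antitranspose.Comparable a b ↔ f.Comparable a b := by
  have h1 : f.antitranspose.LeftOf = f.Above := by
    funext a b; exact propext leftOf_antitranspose
  have h2 : f.antitranspose.Above = f.LeftOf := by
    funext a b; exact propext above_antitranspose
  simp only [Comparable, h1, h2]
  tauto

lemma comparable_reflectHorizontal : f.reflectHorizontal.Comparable a b ↔ f.Comparable a b := by
  have h1 : f.reflectHorizontal.LeftOf = f.LeftOf := by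
    funext a b; exact propext leftOf_reflectHorizontal
  have h2 : f.reflectHorizontal.Above = Function.swap f.Above := by
    funext a b; exact propext above_reflectHorizontal
  simp only [Comparable, h1, h2, Relation.transGen_swap]
  tauto

lemma Comparable.symm (h : f.Comparable a b) : f.Comparable b a := by
  simp only [Comparable] at h ⊢
  tauto

lemma IsTiling.right_le_left (h : f.IsTiling) (hab : Relation.TransGen f.LeftOf a b) :
    (f.room a).right ≤ (f.room b).left := by
  induction hab with
  | single hab => exact hab.2.2.1.le
  | tail _ hbc ih => linarith [hbc.2.2.1, (h.room_proper _ hbc.1).1]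

lemma IsTiling.top_le_bottom (h : f.IsTiling) (hab : Relation.TransGen f.Above a b) :
    (f.room b).top ≤ (f.room a).bottom := by
  induction hab with
  | single hab => exact hab.2.2.1.ge
  | tail _ hbc ih => linarith [hbc.2.2.1, (h.room_proper _ hbc.1).2]

/-- A room as wide as the bounding rectangle is above every room which hangs below it. -/
lemma IsTiling.above_of_spanning (h : f.IsTiling) (ha : a ∈ f.rooms) (hb : b ∈ f.rooms)
    (hl : (f.room a).left = f.box.left) (hr : (f.room a).right = f.box.right)
    (hab : (f.room a).bottom = (f.room b).top) : f.Above a b := by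
  refine ⟨ha, hb, hab, fun i hi h1 h2 h3 => ?_⟩
  obtain ⟨⟨b1, b2⟩, b3, b4⟩ := h.room_bounds hi
  obtain ⟨p1, p2⟩ := h.room_proper i hi
  obtain ⟨q1, q2⟩ := h.room_proper a ha
  have : i = a := h.eq_of_overlap hi ha (by linarith) (by linarith) (by linarith) h2
  subst this
  exact absurd h1 (lt_irrefl _)

/-- A room `a` along the whole top side and a room `b` along the whole bottom side are comparable,
if all other rooms are comparable to `b`. -/
lemma IsTiling.comparable_of_spanning (h : f.IsTiling) (ha : f.IsTopLeftRoom a) (hb : b ∈ f.rooms)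
    (hab : a ≠ b) (har : (f.room a).right = f.box.right)
    (hbl : (f.room b).left = f.box.left) (hbr : (f.room b).right = f.box.right)
    (hbb : (f.room b).bottom = f.box.bottom)
    (H : ∀ c ∈ f.rooms, c ≠ a → c ≠ b → f.Comparable c b) : f.Comparable a b := by
  obtain ⟨ham, hal, hat⟩ := ha
  obtain ⟨pb1, pb2⟩ := h.room_proper b hb
  obtain ⟨pa1, pa2⟩ := h.room_proper a ham
  have hbel : (f.room b).top ≤ (f.room a).bottom := by
    rcases h.separated ham hb hab with h1 | h1 | h1 | h1 <;>
      linarith [(h.room_bounds hb).2.2]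
  -- The room `c` below the left end of the bottom edge of `a` links `a` to `b`: as `b` has full
  -- width and lies at the bottom, comparability of `c` and `b` can only mean that `c` is above `b`.
  obtain ⟨c, hc, hc1, hc2⟩ := h.exists_room_SE (x := f.box.left) (y := (f.room a).bottom)
    le_rfl h.box_proper.1 (by linarith) (by linarith)
  have hca : c ≠ a := by rintro rfl; linarith
  obtain ⟨pc1, pc2⟩ := h.room_proper c hc
  obtain ⟨⟨bc1, bc2⟩, bc3, bc4⟩ := h.room_bounds hc
  have hac : f.Above a c := h.above_of_spanning ham hc hal har (by
    rcases h.separated ham hc hca.symm with h1 | h1 | h1 | h1 <;> linarith)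
  rcases eq_or_ne c b with rfl | hcb
  · exact .inr (.inl (.single hac))
  rcases H c hc hca hcb with (h1 | h1) | (h1 | h1)
  · linarith [h.right_le_left h1]
  · linarith [h.right_le_left h1]
  · exact .inr (.inl (.head hac h1))
  · linarith [h.top_le_bottom h1]

/-! ### Existence and properties of deletion orders -/

variable [DecidableEq ι]

/-- Together with the exchange of junction types, this reduces the second deletion rule to the
first. -/
lemma antitranspose_shiftBottomUp (f : Dissection ι) (b : ι) :
    (f.shiftBottomUp b).antitranspose = f.antitranspose.shiftRightLeft b := by
  simp only [antitranspose, map, shiftBottomUp, shiftRightLeft, mk.injEq, true_and]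
  funext i
  simp only [Rect.antitranspose, neg_inj, neg_le_neg_iff]
  by_cases hc : (f.room i).top = (f.room b).bottom ∧ (f.room b).left ≤ (f.room i).left ∧
      (f.room i).right ≤ (f.room b).right
  · rw [if_pos hc, if_pos ⟨hc.1, hc.2.2, hc.2.1⟩]
  · rw [if_neg hc, if_neg fun hn => hc ⟨hn.1, hn.2.2, hn.2.1⟩]

lemma antitranspose_shiftRightLeft (f : Dissection ι) (b : ι) :
    (f.shiftRightLeft b).antitranspose = f.antitranspose.shiftBottomUp b := by
  rw [← antitranspose_antitranspose (f.antitranspose.shiftBottomUp b),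
    antitranspose_shiftBottomUp, antitranspose_antitranspose]

lemma IsTopLeftDeletion.antitranspose (h : f.IsTopLeftDeletion b f') :
    f.antitranspose.IsTopLeftDeletion b f'.antitranspose := by
  refine ⟨h.1.antitranspose, ?_⟩
  simp only [antitranspose_room, Rect.antitranspose, isLeftTee_antitranspose,
    isUpTee_antitranspose, neg_neg]
  rcases h.2 with ⟨h1, rfl⟩ | ⟨h1, rfl⟩
  · exact .inr ⟨h1, antitranspose_shiftBottomUp f b⟩
  · exact .inl ⟨h1, antitranspose_shiftRightLeft f b⟩

lemma IsTopLeftOrder.antitranspose {l : List ι} (h : f.IsTopLeftOrder l) :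
    f.antitranspose.IsTopLeftOrder l := by
  induction h with
  | last f b h => exact .last _ b h
  | delete f f' b l h _ ih => exact .delete _ _ b l h.antitranspose ih

/-- Block deletion yields a mosaic floorplan and keeps the relations of the remaining rooms. -/
lemma IsTopLeftDeletion.spec (hd : f.IsTopLeftDeletion b f') (h : f.IsMosaic) :
    f'.IsMosaic ∧ f'.rooms = f.rooms.erase b ∧ ∀ a c, a ≠ b → c ≠ b →
      (f'.LeftOf a c ↔ f.LeftOf a c) ∧ (f'.Above a c ↔ f.Above a c) := by
  rcases hd.2 with ⟨h1, rfl⟩ | ⟨h1, rfl⟩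
  · have hb := h.isTiling.hasLeftTeeCorner hd.1 h1
    exact ⟨hb.shiftBottomUp_isMosaic h, rfl, fun a c ha hc =>
      ⟨hb.leftOf_shiftBottomUp h.isTiling ha hc, hb.above_shiftBottomUp h.isTiling ha hc⟩⟩
  · have ht := h.isTiling.antitranspose
    have hb := ht.hasLeftTeeCorner hd.1.antitranspose (by
      simpa only [antitranspose_room, Rect.antitranspose, isLeftTee_antitranspose, neg_neg]
        using h1)
    have e := antitranspose_shiftRightLeft f b
    refine ⟨?_, rfl, fun a c ha hc => ⟨?_, ?_⟩⟩
    · rw [← antitranspose_antitranspose (f.shiftRightLeft b), e]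
      exact (hb.shiftBottomUp_isMosaic h.antitranspose).antitranspose
    · rw [← above_antitranspose, e, hb.above_shiftBottomUp ht ha hc, above_antitranspose]
    · rw [← leftOf_antitranspose, e, hb.leftOf_shiftBottomUp ht ha hc, leftOf_antitranspose]

lemma IsMosaic.exists_deletion (h : f.IsMosaic) (hb : f.IsTopLeftRoom b)
    (hc : c ∈ f.rooms) (hcb : c ≠ b) : ∃ f', f.IsTopLeftDeletion b f' := by
  rcases h.isTee_of_isTopLeftRoom hb hc hcb with h1 | h1
  · exact ⟨_, hb, .inl ⟨h1, rfl⟩⟩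
  · exact ⟨_, hb, .inr ⟨h1, rfl⟩⟩

lemma IsMosaic.exists_topLeftOrder (h : f.IsMosaic) : ∃ l, f.IsTopLeftOrder l := by
  induction hn : f.rooms.card generalizing f with
  | zero =>
    obtain ⟨b, hb⟩ := h.isTiling.exists_topLeftRoom
    exact absurd (Finset.card_eq_zero.1 hn ▸ hb.1) (Finset.notMem_empty b)
  | succ n ih =>
    obtain ⟨b, hb⟩ := h.isTiling.exists_topLeftRoom
    by_cases hs : ∃ c ∈ f.rooms, c ≠ b
    · obtain ⟨c, hc, hcb⟩ := hs
      obtain ⟨f', hd⟩ := h.exists_deletion hb hc hcb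
      obtain ⟨hm, hr, -⟩ := hd.spec h
      obtain ⟨l, hl⟩ := ih hm (by rw [hr, Finset.card_erase_of_mem hb.1, hn]; rfl)
      exact ⟨b :: l, .delete _ _ _ _ hd hl⟩
    · push Not at hs
      exact ⟨[b], .last _ _ (Finset.eq_singleton_iff_unique_mem.2 ⟨hb.1, hs⟩)⟩

/-- The deletion order lists all rooms once, and extends the relations `LeftOf` and `Above`. -/
lemma IsTopLeftOrder.spec {l : List ι} (hl : f.IsTopLeftOrder l) (h : f.IsMosaic) :
    l.Nodup ∧ (∀ i, i ∈ l ↔ i ∈ f.rooms) ∧ l.Pairwise fun a c => ¬ f.LeftOf c a ∧ ¬ f.Above c a := by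
  induction hl with
  | last f b hb => simp [hb]
  | delete f f' b l hd _ ih =>
    obtain ⟨hm, hr, hrel⟩ := hd.spec h
    obtain ⟨h1, h2, h3⟩ := ih hm
    have hmem : ∀ i, i ∈ l ↔ i ≠ b ∧ i ∈ f.rooms := by simp [h2, hr]
    refine ⟨List.nodup_cons.2 ⟨fun hb => ((hmem b).1 hb).1 rfl, h1⟩, fun i => ?_,
      List.pairwise_cons.2 ⟨fun c hc => ⟨fun hlo => ?_, fun hab => ?_⟩, ?_⟩⟩
    · rw [List.mem_cons, hmem]
      by_cases hib : i = b
      · simp [hib, hd.1.1]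
      · simp [hib]
    -- The deleted room touches the left and the top side of the box, so no room is left of it or
    -- above it.
    · have hp := h.room_proper c hlo.1
      have hb := h.isTiling.room_bounds hlo.1
      linarith [hp.1, hlo.2.2.1, hd.1.2.1]
    · have hp := h.room_proper c hab.1
      have hb := h.isTiling.room_bounds hab.1
      linarith [hp.2, hab.2.2.1, hd.1.2.2]
    · refine h3.imp_of_mem fun {a c} ha hc hac => ?_
      have := hrel c a ((hmem c).1 hc).1 ((hmem a).1 ha).1
      rwa [this.1, this.2] at hac

/-- Induction on the number of rooms. Deleting any of the four corner rooms keeps the relations of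
the others, so in an incomparable pair each corner room is one of the two. Rooms at opposite corners
differ, hence the pair occupies two full opposite sides of the box, and this case is handled by
`IsTiling.comparable_of_spanning`. -/
theorem IsMosaic.comparable (h : f.IsMosaic) (ha : a ∈ f.rooms) (hb : b ∈ f.rooms)
    (hab : a ≠ b) : f.Comparable a b := by
  induction hn : f.rooms.card generalizing f a b with
  | zero => simp [Finset.card_eq_zero.1 hn] at ha
  | succ n ih =>
    -- Stated for a floorplan `g` on the same rooms, in order to apply to the reflected images of
    -- `f` and so to all four corners.
    have red : ∀ {g : Dissection ι}, g.IsMosaic → g.rooms = f.rooms → ∀ {z : ι},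
        g.IsTopLeftRoom z → ∀ {x y : ι}, x ∈ f.rooms → y ∈ f.rooms → x ≠ z → y ≠ z → x ≠ y →
        g.Comparable x y := by
      intro g hg hgf z hz x y hx hy hxz hyz hxy
      obtain ⟨g', hd⟩ := hg.exists_deletion hz (hgf ▸ hx) hxz
      obtain ⟨hm, hr, hrel⟩ := hd.spec hg
      have hmem : ∀ i ∈ g'.rooms, i ≠ z := fun i hi => by
        rw [hr] at hi; exact Finset.ne_of_mem_erase hi
      have hL : ∀ i j, g'.LeftOf i j → g.LeftOf i j := fun i j hij =>
        (hrel i j (hmem i hij.1) (hmem j hij.2.1)).1.1 hij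
      have hA : ∀ i j, g'.Above i j → g.Above i j := fun i j hij =>
        (hrel i j (hmem i hij.1) (hmem j hij.2.1)).2.1 hij
      have hc := ih hm (a := x) (b := y) (by simp [hr, hgf, hx, hxz]) (by simp [hr, hgf, hy, hyz])
        hxy (by rw [hr, Finset.card_erase_of_mem hz.1, hgf, hn]; rfl)
      exact hc.imp (Or.imp (.mono hL _ _) (.mono hL _ _)) (Or.imp (.mono hA _ _) (.mono hA _ _))
    have span : ∀ {g : Dissection ι}, g.IsMosaic → g.rooms = f.rooms → ∀ {x y : ι},
        g.IsTopLeftRoom x → y ∈ f.rooms → x ≠ y → (g.room x).right = g.box.right →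
        (g.room y).left = g.box.left → (g.room y).right = g.box.right →
        (g.room y).bottom = g.box.bottom → g.Comparable x y := by
      intro g hg hgf x y hx hy hxy h1 h2 h3 h4
      exact hg.isTiling.comparable_of_spanning hx (hgf ▸ hy) hxy h1 h2 h3 h4
        fun c hc hcx hcy => red hg hgf hx (hgf ▸ hc) hy hcx hxy.symm hcy
    by_contra hcon
    have hm1 := h.reflectHorizontal
    have hm2 := hm1.antitranspose
    have hm3 := hm2.reflectHorizontal
    have hmQ := h.antitranspose
    have hm4 := hmQ.reflectHorizontal
    -- In `f`, the rooms `u`, `v`, `w`, `z` are those at the top left, bottom left, top right and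
    -- bottom right corners.
    obtain ⟨u, hu⟩ := h.isTiling.exists_topLeftRoom
    obtain ⟨v, hv⟩ := hm1.isTiling.exists_topLeftRoom
    obtain ⟨w, hw⟩ := hm4.isTiling.exists_topLeftRoom
    have hm5 := hm4.antitranspose.reflectHorizontal
    obtain ⟨z, hz⟩ := hm5.isTiling.exists_topLeftRoom
    have cu : u = a ∨ u = b := by
      by_contra! hc
      exact hcon (red h rfl hu ha hb hc.1.symm hc.2.symm hab)
    have cv : v = a ∨ v = b := by
      by_contra! hc
      exact hcon (comparable_reflectHorizontal.1 (red hm1 rfl hv ha hb hc.1.symm hc.2.symm hab))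
    have cw : w = a ∨ w = b := by
      by_contra! hc
      exact hcon (comparable_antitranspose.1 (comparable_reflectHorizontal.1
        (red hm4 rfl hw ha hb hc.1.symm hc.2.symm hab)))
    have cz : z = a ∨ z = b := by
      by_contra! hc
      exact hcon (comparable_antitranspose.1 (comparable_reflectHorizontal.1
        (comparable_antitranspose.1 (comparable_reflectHorizontal.1
        (red hm5 rfl hz ha hb hc.1.symm hc.2.symm hab)))))
    have hv' := hv
    have hw' := hw
    have hz' := hz
    simp only [IsTopLeftRoom, reflectHorizontal_box, antitranspose_box, reflectHorizontal_room,
      antitranspose_room, Rect.antitranspose, Rect.reflectHorizontal, neg_neg, neg_inj]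
      at hv' hw' hz'
    have hu' := hu
    simp only [IsTopLeftRoom] at hu'
    have ht := h.isTiling
    -- A room at two opposite corners would be the whole box and leave no space for a second one.
    have huz : u ≠ z := by
      rintro rfl
      have hx : ∃ c ∈ f.rooms, c ≠ u := by
        rcases cu with rfl | rfl
        · exact ⟨b, hb, hab.symm⟩
        · exact ⟨a, ha, hab⟩
      obtain ⟨c, hc, hcu⟩ := hx
      have := ht.separated hc hu'.1 hcu
      have := ht.room_bounds hc
      obtain ⟨p1, p2⟩ := ht.room_proper c hc
      grind
    have hvw : v ≠ w := by
      rintro rfl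
      have hx : ∃ c ∈ f.rooms, c ≠ v := by
        rcases cv with rfl | rfl
        · exact ⟨b, hb, hab.symm⟩
        · exact ⟨a, ha, hab⟩
      obtain ⟨c, hc, hcu⟩ := hx
      have := ht.separated hc hv'.1 hcu
      have := ht.room_bounds hc
      obtain ⟨p1, p2⟩ := ht.room_proper c hc
      grind
    have hcon' : ¬ f.Comparable u z := by
      rcases cu with rfl | rfl <;> rcases cz with rfl | rfl
      · exact absurd rfl huz
      · exact hcon
      · exact fun hc => hcon hc.symm
      · exact absurd rfl huz
    -- Either one room fills the top side and the other the bottom side, or one fills the left side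
    -- and the other the right side.
    have hcase : (w = u ∧ v = z) ∨ (w = z ∧ v = u) := by grind
    rcases hcase with ⟨rfl, rfl⟩ | ⟨rfl, rfl⟩
    · exact hcon' (span h rfl hu hv'.1 huz (by grind) (by grind) (by grind) (by grind))
    · refine hcon' (comparable_antitranspose.1 (span hmQ rfl hu.antitranspose hw'.1 huz ?_ ?_ ?_ ?_))
      all_goals
        simp only [antitranspose_box, antitranspose_room, Rect.antitranspose, neg_inj]
        grind

end Dissection

/-- Reading backwards exchanges the two forbidden patterns 2-41-3 and 3-14-2. -/
lemma IsBaxter.reverse {n : ℕ} {π : Equiv.Perm (Fin n)} (h : IsBaxter π) :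
    IsBaxter (reverse π) := by
  rintro ⟨i, j, k, l, hij, hjk, hkl, hp⟩
  refine h ⟨l.rev, k.rev, j.rev, i.rev, Fin.rev_lt_rev.2 hkl, Fin.rev_lt_rev.2 hjk,
    Fin.rev_lt_rev.2 hij, ?_⟩
  simp only [Floorplan.reverse, Equiv.trans_apply, Fin.revPerm_apply] at hp
  omega

namespace Dissection

variable {ι κ : Type*} {f : Dissection ι} {n : ℕ}

/-! ### Linear extensions of the relations -/

/-- An enumeration of the rooms which is compatible with `LeftOf` and `Above`. -/
structure IsLinearExtension (f : Dissection ι) (σ : Fin n → ι) : Prop where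
  injective : Function.Injective σ
  mem_iff : ∀ a, a ∈ f.rooms ↔ ∃ i, σ i = a
  lt_of_leftOf : ∀ i j, f.LeftOf (σ i) (σ j) → i < j
  lt_of_above : ∀ i j, f.Above (σ i) (σ j) → i < j

namespace IsLinearExtension

variable {σ τ : Fin n → ι}

lemma card_rooms (hσ : f.IsLinearExtension σ) : f.rooms.card = n := by
  have : f.rooms = Finset.univ.map ⟨σ, hσ.injective⟩ := by
    ext a; simp [hσ.mem_iff]
  simp [this]

lemma lt_of_transGen_leftOf (hσ : f.IsLinearExtension σ) {i j : Fin n}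
    (h : Relation.TransGen f.LeftOf (σ i) (σ j)) : i < j := by
  suffices ∀ b, Relation.TransGen f.LeftOf (σ i) b → ∀ j, σ j = b → i < j from this _ h j rfl
  intro b hb
  induction hb with
  | single hb => rintro j rfl; exact hσ.lt_of_leftOf _ _ hb
  | tail _ hbc ih =>
    rintro j rfl
    obtain ⟨k, rfl⟩ := (hσ.mem_iff _).1 hbc.1
    exact (ih k rfl).trans (hσ.lt_of_leftOf _ _ hbc)

lemma lt_of_transGen_above (hσ : f.IsLinearExtension σ) {i j : Fin n}
    (h : Relation.TransGen f.Above (σ i) (σ j)) : i < j := by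
  suffices ∀ b, Relation.TransGen f.Above (σ i) b → ∀ j, σ j = b → i < j from this _ h j rfl
  intro b hb
  induction hb with
  | single hb => rintro j rfl; exact hσ.lt_of_above _ _ hb
  | tail _ hbc ih =>
    rintro j rfl
    obtain ⟨k, rfl⟩ := (hσ.mem_iff _).1 hbc.1
    exact (ih k rfl).trans (hσ.lt_of_above _ _ hbc)

/-- For distinct rooms, the order of the indices tells the direction of comparison. -/
lemma transGen_of_lt [DecidableEq ι] (hσ : f.IsLinearExtension σ) (h : f.IsMosaic) {i j : Fin n}
    (hij : i < j) :
    Relation.TransGen f.LeftOf (σ i) (σ j) ∨ Relation.TransGen f.Above (σ i) (σ j) := by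
  rcases h.comparable ((hσ.mem_iff _).2 ⟨i, rfl⟩) ((hσ.mem_iff _).2 ⟨j, rfl⟩)
    (hσ.injective.ne hij.ne) with (h1 | h1) | (h1 | h1)
  · exact .inl h1
  · exact absurd (hσ.lt_of_transGen_leftOf h1) hij.not_gt
  · exact .inr h1
  · exact absurd (hσ.lt_of_transGen_above h1) hij.not_gt

/-- By comparability, the passage from one enumeration to the other is strictly monotone on `Fin n`,
hence the identity. -/
lemma unique [DecidableEq ι] (hσ : f.IsLinearExtension σ) (hτ : f.IsLinearExtension τ)
    (h : f.IsMosaic) : σ = τ := by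
  have hex : ∀ i, ∃ j, τ j = σ i := fun i => (hτ.mem_iff _).1 ((hσ.mem_iff _).2 ⟨i, rfl⟩)
  choose e he using hex
  have hmono : StrictMono e := by
    intro i j hij
    rcases hσ.transGen_of_lt h hij with h1 | h1 <;> rw [← he, ← he] at h1
    · exact hτ.lt_of_transGen_leftOf h1
    · exact hτ.lt_of_transGen_above h1
  funext i
  rw [← he, hmono.eq_id, id]

end IsLinearExtension

/-- Reversing a bottom-left order yields a bottom-left order of the antitransposed floorplan. -/
lemma IsLinearExtension.comp_rev {τ : Fin n → ι}
    (hτ : f.reflectHorizontal.IsLinearExtension τ) :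
    f.antitranspose.reflectHorizontal.IsLinearExtension (τ ∘ Fin.rev) where
  injective := hτ.injective.comp Fin.rev_injective
  mem_iff a := by
    refine (hτ.mem_iff a).trans ⟨fun ⟨i, hi⟩ => ⟨i.rev, by simpa using hi⟩, fun ⟨i, hi⟩ => ⟨_, hi⟩⟩
  lt_of_leftOf i j hij := by
    rw [leftOf_reflectHorizontal, leftOf_antitranspose] at hij
    exact Fin.rev_lt_rev.1 (hτ.lt_of_above _ _ (above_reflectHorizontal.2 hij))
  lt_of_above i j hij := by
    rw [above_reflectHorizontal, above_antitranspose] at hij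
    exact Fin.rev_lt_rev.1 (hτ.lt_of_leftOf _ _ (leftOf_reflectHorizontal.2 hij))

section

variable [DecidableEq ι] {σ τ : Fin n → ι}

lemma IsTopLeftOrder.isLinearExtension (hσ : f.IsTopLeftOrder (List.ofFn σ)) (h : f.IsMosaic) :
    f.IsLinearExtension σ := by
  obtain ⟨h1, h2, h3⟩ := hσ.spec h
  rw [List.nodup_ofFn] at h1
  rw [List.pairwise_ofFn] at h3
  refine ⟨h1, fun a => by rw [← h2, List.mem_ofFn']; rfl, fun i j hij => ?_, fun i j hij => ?_⟩
  · rcases lt_trichotomy i j with hlt | rfl | hlt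
    · exact hlt
    · exact absurd hij.2.2.1 (h.room_proper _ hij.1).1.ne'
    · exact absurd hij (h3 hlt).1
  · rcases lt_trichotomy i j with hlt | rfl | hlt
    · exact hlt
    · exact absurd hij.2.2.1 (h.room_proper _ hij.1).2.ne
    · exact absurd hij (h3 hlt).2

lemma IsMosaic.exists_topLeftOrder_ofFn (h : f.IsMosaic) (hn : f.rooms.card = n) :
    ∃ σ : Fin n → ι, f.IsTopLeftOrder (List.ofFn σ) := by
  obtain ⟨l, hl⟩ := h.exists_topLeftOrder
  obtain ⟨h1, h2, -⟩ := hl.spec h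
  have : l.length = n := by
    rw [← hn, ← List.toFinset_card_of_nodup h1]
    congr 1
    ext a
    simp [h2]
  subst this
  exact ⟨l.get, by rwa [List.ofFn_get]⟩

/-- The order `σ` serves both floorplans. The new floorplan has some bottom-left order `ρ`, which by
uniqueness of linear extensions is `τ` read backwards. -/
theorem CorrespondsTo.antitranspose {π : Equiv.Perm (Fin n)} (h : f.CorrespondsTo π) :
    f.antitranspose.CorrespondsTo (reverse π) := by
  obtain ⟨hm, σ, τ, hσ, hτ, hk⟩ := h
  have hτ' := IsTopLeftOrder.isLinearExtension hτ hm.reflectHorizontal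
  have hm' := hm.antitranspose.reflectHorizontal
  obtain ⟨ρ, hρ⟩ := hm'.exists_topLeftOrder_ofFn hτ'.card_rooms
  have e := (hρ.isLinearExtension hm').unique hτ'.comp_rev hm'
  refine ⟨hm.antitranspose, σ, ρ, hσ.antitranspose, hρ, fun k => ?_⟩
  rw [e, Function.comp_apply, hk]
  rfl

end

/-! ### The permutation determines the relations -/

/-- A room strictly between `a` and `b` would have to fit its positive width between two equal
abscissae. Conversely, the first step of a chain from `a` to `b` must already reach `b`. -/
lemma IsTiling.leftOf_iff_covers (h : f.IsTiling) {a b : ι} : f.LeftOf a b ↔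
    Relation.TransGen f.LeftOf a b ∧
      ∀ c, Relation.TransGen f.LeftOf a c → ¬ Relation.TransGen f.LeftOf c b := by
  constructor
  · refine fun hab => ⟨.single hab, fun c hac hcb => ?_⟩
    have hc : c ∈ f.rooms := by
      rcases hac with hac | ⟨-, hac⟩ <;> exact hac.2.1
    linarith [h.right_le_left hac, h.right_le_left hcb, hab.2.2.1, (h.room_proper c hc).1]
  · rintro ⟨hab, H⟩
    obtain ⟨c, hac, hcb⟩ := Relation.TransGen.head'_iff.1 hab
    rcases Relation.reflTransGen_iff_eq_or_transGen.1 hcb with rfl | hcb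
    · exact hac
    · exact absurd hcb (H c (.single hac))

lemma IsTiling.above_iff_covers (h : f.IsTiling) {a b : ι} : f.Above a b ↔
    Relation.TransGen f.Above a b ∧
      ∀ c, Relation.TransGen f.Above a c → ¬ Relation.TransGen f.Above c b := by
  have e : f.antitranspose.LeftOf = f.Above := by
    funext a b; exact propext leftOf_antitranspose
  have := h.antitranspose.leftOf_iff_covers (a := a) (b := b)
  rwa [e] at this

lemma transGen_reflectHorizontal_above {a b : ι} :
    Relation.TransGen f.reflectHorizontal.Above a b ↔ Relation.TransGen f.Above b a := by
  have : f.reflectHorizontal.Above = Function.swap f.Above := by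
    funext a b; exact propext above_reflectHorizontal
  rw [this, Relation.transGen_swap]

lemma transGen_reflectHorizontal_leftOf {a b : ι} :
    Relation.TransGen f.reflectHorizontal.LeftOf a b ↔ Relation.TransGen f.LeftOf a b := by
  have : f.reflectHorizontal.LeftOf = f.LeftOf := by
    funext a b; exact propext leftOf_reflectHorizontal
  rw [this]

/-- The rooms of a floorplan, indexed by an enumeration. -/
noncomputable def IsLinearExtension.equiv {τ : Fin n → ι}
    (hτ : f.IsLinearExtension τ) : Fin n ≃ {i // i ∈ f.rooms} :=
  Equiv.ofBijective (fun k => ⟨τ k, (hτ.mem_iff _).2 ⟨k, rfl⟩⟩)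
    ⟨fun _ _ hij => hτ.injective (Subtype.ext_iff.1 hij),
      fun a => ((hτ.mem_iff a.1).1 a.2).imp fun _ hi => Subtype.ext hi⟩

/-- A matching of the rooms which respects the relations. -/
def IsRelIso (f : Dissection ι) (g : Dissection κ)
    (e : {i // i ∈ f.rooms} ≃ {j // j ∈ g.rooms}) : Prop :=
  ∀ a b : {i // i ∈ f.rooms}, (f.LeftOf a b ↔ g.LeftOf (e a) (e b)) ∧ (f.Above a b ↔ g.Above (e a) (e b))

/-- A matching of rooms which respects the relations transports linear extensions. -/
lemma IsRelIso.isLinearExtension {g : Dissection κ}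
    {e : {i // i ∈ f.rooms} ≃ {j // j ∈ g.rooms}} (he : IsRelIso f g e) {ρ : Fin n → κ}
    (hρ : g.IsLinearExtension ρ) :
    f.IsLinearExtension fun k => (e.symm (hρ.equiv k) : ι) where
  injective i j hij := hρ.equiv.injective (e.symm.injective (Subtype.ext hij))
  mem_iff a := by
    constructor
    · intro ha
      obtain ⟨k, hk⟩ := hρ.equiv.surjective (e ⟨a, ha⟩)
      exact ⟨k, by simp [hk]⟩
    · rintro ⟨k, rfl⟩
      exact (e.symm _).2
  lt_of_leftOf i j hij := by
    rw [(he _ _).1, e.apply_symm_apply, e.apply_symm_apply] at hij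
    exact hρ.lt_of_leftOf i j hij
  lt_of_above i j hij := by
    rw [(he _ _).2, e.apply_symm_apply, e.apply_symm_apply] at hij
    exact hρ.lt_of_above i j hij

lemma IsRelIso.symm {g : Dissection κ} {e : {i // i ∈ f.rooms} ≃ {j // j ∈ g.rooms}}
    (he : IsRelIso f g e) : IsRelIso g f e.symm := fun a b => by
  have := he (e.symm a) (e.symm b)
  rw [e.apply_symm_apply, e.apply_symm_apply] at this
  exact ⟨this.1.symm, this.2.symm⟩

lemma IsRelIso.reflectHorizontal {g : Dissection κ}
    {e : {i // i ∈ f.rooms} ≃ {j // j ∈ g.rooms}} (he : IsRelIso f g e) :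
    IsRelIso f.reflectHorizontal g.reflectHorizontal e := by
  intro a b
  rw [leftOf_reflectHorizontal, leftOf_reflectHorizontal, above_reflectHorizontal,
    above_reflectHorizontal]
  exact ⟨(he a b).1, (he b a).2⟩

section

variable [DecidableEq ι] {σ τ : Fin n → ι} {π : Equiv.Perm (Fin n)}

lemma IsMosaic.transGen_leftOf_iff (h : f.IsMosaic) (hσ : f.IsLinearExtension σ)
    (hτ : f.reflectHorizontal.IsLinearExtension τ) (hk : ∀ k, τ k = σ (π k)) (i j : Fin n) :
    Relation.TransGen f.LeftOf (τ i) (τ j) ↔ π i < π j ∧ i < j := by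
  constructor
  · intro hij
    refine ⟨hσ.lt_of_transGen_leftOf (by rwa [← hk, ← hk]), hτ.lt_of_transGen_leftOf ?_⟩
    rwa [transGen_reflectHorizontal_leftOf]
  · rintro ⟨h1, h2⟩
    have h1 := hσ.transGen_of_lt h h1
    rw [← hk, ← hk] at h1
    refine h1.resolve_right fun h3 => ?_
    exact absurd (hτ.lt_of_transGen_above (transGen_reflectHorizontal_above.2 h3)) h2.not_gt

lemma IsMosaic.transGen_above_iff (h : f.IsMosaic) (hσ : f.IsLinearExtension σ)
    (hτ : f.reflectHorizontal.IsLinearExtension τ) (hk : ∀ k, τ k = σ (π k)) (i j : Fin n) :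
    Relation.TransGen f.Above (τ i) (τ j) ↔ π i < π j ∧ j < i := by
  constructor
  · intro hij
    refine ⟨hσ.lt_of_transGen_above (by rwa [← hk, ← hk]), hτ.lt_of_transGen_above ?_⟩
    rwa [transGen_reflectHorizontal_above]
  · rintro ⟨h1, h2⟩
    have h1 := hσ.transGen_of_lt h h1
    rw [← hk, ← hk] at h1
    refine h1.resolve_left fun h3 => ?_
    exact absurd (hτ.lt_of_transGen_leftOf (transGen_reflectHorizontal_leftOf.2 h3)) h2.not_gt

/-- The right-hand side involves only `π`, which is why the permutation determines the relation. -/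
lemma IsMosaic.leftOf_iff (h : f.IsMosaic) (hσ : f.IsLinearExtension σ)
    (hτ : f.reflectHorizontal.IsLinearExtension τ) (hk : ∀ k, τ k = σ (π k)) (i j : Fin n) :
    f.LeftOf (τ i) (τ j) ↔ (π i < π j ∧ i < j) ∧
      ∀ k, (π i < π k ∧ i < k) → ¬ (π k < π j ∧ k < j) := by
  rw [h.isTiling.leftOf_iff_covers, h.transGen_leftOf_iff hσ hτ hk]
  refine and_congr_right fun _ => ⟨fun H k => ?_, fun H c h1 h2 => ?_⟩
  · rw [← h.transGen_leftOf_iff hσ hτ hk, ← h.transGen_leftOf_iff hσ hτ hk]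
    exact H (τ k)
  · obtain ⟨k, rfl⟩ := (hτ.mem_iff c).1 (by rcases h1 with h1 | ⟨-, h1⟩ <;> exact h1.2.1)
    rw [h.transGen_leftOf_iff hσ hτ hk] at h1 h2
    exact H k h1 h2

lemma IsMosaic.above_iff (h : f.IsMosaic) (hσ : f.IsLinearExtension σ)
    (hτ : f.reflectHorizontal.IsLinearExtension τ) (hk : ∀ k, τ k = σ (π k)) (i j : Fin n) :
    f.Above (τ i) (τ j) ↔ (π i < π j ∧ j < i) ∧
      ∀ k, (π i < π k ∧ k < i) → ¬ (π k < π j ∧ j < k) := by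
  rw [h.isTiling.above_iff_covers, h.transGen_above_iff hσ hτ hk]
  refine and_congr_right fun _ => ⟨fun H k => ?_, fun H c h1 h2 => ?_⟩
  · rw [← h.transGen_above_iff hσ hτ hk, ← h.transGen_above_iff hσ hτ hk]
    exact H (τ k)
  · obtain ⟨k, rfl⟩ := (hτ.mem_iff c).1 (by rcases h1 with h1 | ⟨-, h1⟩ <;> exact h1.2.1)
    rw [h.transGen_above_iff hσ hτ hk] at h1 h2
    exact H k h1 h2

/-- Floorplans with the same permutation have the same relations. -/
theorem CorrespondsTo.exists_isRelIso [DecidableEq κ] {g : Dissection κ} (hf : f.CorrespondsTo π)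
    (hg : g.CorrespondsTo π) : ∃ e, IsRelIso f g e := by
  obtain ⟨hm, σ, τ, hσ, hτ, hk⟩ := hf
  obtain ⟨hm', σ', τ', hσ', hτ', hk'⟩ := hg
  have hσ := hσ.isLinearExtension hm
  have hσ' := hσ'.isLinearExtension hm'
  have hτ := IsTopLeftOrder.isLinearExtension hτ hm.reflectHorizontal
  have hτ' := IsTopLeftOrder.isLinearExtension hτ' hm'.reflectHorizontal
  -- Rooms are matched by their position in the bottom-left orders.
  let E : Fin n ≃ {i // i ∈ f.rooms} := hτ.equiv
  let E' : Fin n ≃ {j // j ∈ g.rooms} := hτ'.equiv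
  refine ⟨E.symm.trans E', fun a b => ?_⟩
  obtain ⟨i, rfl⟩ := E.surjective a
  obtain ⟨j, rfl⟩ := E.surjective b
  simp only [Equiv.trans_apply, Equiv.symm_apply_apply]
  exact ⟨(hm.leftOf_iff hσ hτ hk i j).trans (hm'.leftOf_iff hσ' hτ' hk' i j).symm,
    (hm.above_iff hσ hτ hk i j).trans (hm'.above_iff hσ' hτ' hk' i j).symm⟩

/-- The deletion orders of `g`, pulled back along the matching, are linear extensions for `f`, hence
equal to those of `f` by uniqueness. -/
theorem CorrespondsTo.of_isRelIso [DecidableEq κ] {g : Dissection κ} (hf : f.CorrespondsTo π)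
    (hg : g.IsMosaic) {e : {i // i ∈ f.rooms} ≃ {j // j ∈ g.rooms}} (he : IsRelIso f g e) :
    g.CorrespondsTo π := by
  obtain ⟨hm, σ, τ, hσ, hτ, hk⟩ := hf
  have hσ := hσ.isLinearExtension hm
  have hτ := IsTopLeftOrder.isLinearExtension hτ hm.reflectHorizontal
  have hcard : g.rooms.card = n := by
    rw [← hσ.card_rooms, ← Fintype.card_coe, ← Fintype.card_coe]
    exact (Fintype.card_congr e).symm
  have hg' := hg.reflectHorizontal
  obtain ⟨σ', hσ'⟩ := hg.exists_topLeftOrder_ofFn hcard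
  obtain ⟨τ', hτ'⟩ := hg'.exists_topLeftOrder_ofFn hcard
  have hσl := hσ'.isLinearExtension hg
  have hτl := hτ'.isLinearExtension hg'
  refine ⟨hg, σ', τ', hσ', hτ', fun k => ?_⟩
  have e1 := congrFun ((he.isLinearExtension hσl).unique hσ hm) (π k)
  have e2 := congrFun ((he.reflectHorizontal.isLinearExtension hτl).unique hτ
    hm.reflectHorizontal) k
  have e3 := e2.trans ((hk k).trans e1.symm)
  exact Subtype.ext_iff.1 (e.symm.injective (Subtype.ext e3))

end

end Dissection

/-- The four sides of a rectangle. -/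
inductive Side
  | left
  | right
  | bottom
  | top

/-- The edge of a rectangle on a given side. -/
def Rect.edge (R : Rect) : Side → Set (ℝ × ℝ)
  | .left => R.leftEdge
  | .right => R.rightEdge
  | .bottom => R.bottomEdge
  | .top => R.topEdge

namespace Dissection

variable {ι κ : Type*} {f : Dissection ι}

/-! ### Existence and uniqueness of segments -/

lemma IsTiling.vertical_subset_walls_iff (h : f.IsTiling) {x c d : ℝ} (hcd : c < d) :
    {x} ×ˢ Set.Icc c d ⊆ f.walls ↔ ((f.box.left ≤ x ∧ x ≤ f.box.right) ∧
      f.box.bottom ≤ c ∧ d ≤ f.box.top) ∧ f.VFree x c d := by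
  constructor
  · intro H
    have H' : ∀ y, c ≤ y → y ≤ d → (x, y) ∈ f.walls := fun y h1 h2 => H ⟨rfl, h1, h2⟩
    have hc := (h.mem_walls_iff.1 (H' c le_rfl hcd.le)).1
    have hd := (h.mem_walls_iff.1 (H' d hcd.le le_rfl)).1
    rw [Rect.mem_region] at hc hd
    refine ⟨⟨hc.1, hc.2.1, hd.2.2⟩, fun i hi h1 h2 h3 => ?_⟩
    by_contra! h4
    obtain ⟨y, hy1, hy2⟩ := exists_between
      (max_lt (lt_min hcd h4) (lt_min h3 (h.room_proper i hi).2))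
    rw [max_lt_iff] at hy1
    rw [lt_min_iff] at hy2
    exact (h.mem_walls_iff.1 (H' y hy1.1.le hy2.1.le)).2 i hi
      (Rect.mem_openRegion.2 ⟨⟨h1, h2⟩, hy1.2, hy2.2⟩)
  · rintro ⟨⟨hx, hc, hd⟩, H⟩ ⟨x', y⟩ ⟨rfl, hy1, hy2⟩
    refine h.mem_walls_iff.2 ⟨Rect.mem_region.2 ⟨hx, hc.trans hy1, hy2.trans hd⟩,
      fun i hi hm => ?_⟩
    obtain ⟨⟨h1, h2⟩, h3, h4⟩ := Rect.mem_openRegion.1 hm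
    simp only at hy1 hy2
    linarith [H i hi h1 h2 (by linarith)]

lemma VFree.mono {x c d c' d' : ℝ} (h : f.VFree x c d) (hc : c ≤ c') (hd : d' ≤ d) :
    f.VFree x c' d' :=
  fun i hi h1 h2 h3 => (h i hi h1 h2 (h3.trans_le hd)).trans hc

lemma vertical_subset_vertical {x x' c d c' d' : ℝ} (hcd : c < d)
    (h : ({x} ×ˢ Set.Icc c d : Set (ℝ × ℝ)) ⊆ {x'} ×ˢ Set.Icc c' d') :
    x = x' ∧ c' ≤ c ∧ d ≤ d' := by
  have h1 := h (show (x, c) ∈ _ from ⟨rfl, le_rfl, hcd.le⟩)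
  have h2 := h (show (x, d) ∈ _ from ⟨rfl, hcd.le, le_rfl⟩)
  exact ⟨h1.1, h1.2.1, h2.2.2⟩

lemma not_vertical_subset_horizontal {x c d y a b : ℝ} (hcd : c < d) :
    ¬ ({x} ×ˢ Set.Icc c d : Set (ℝ × ℝ)) ⊆ Set.Icc a b ×ˢ {y} := by
  intro h
  have h1 := h (show (x, c) ∈ _ from ⟨rfl, le_rfl, hcd.le⟩)
  have h2 := h (show (x, d) ∈ _ from ⟨rfl, hcd.le, le_rfl⟩)
  exact hcd.ne (h1.2.trans h2.2.symm)

lemma not_horizontal_subset_vertical {x c d y a b : ℝ} (hab : a < b) :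
    ¬ (Set.Icc a b ×ˢ {y} : Set (ℝ × ℝ)) ⊆ {x} ×ˢ Set.Icc c d := by
  intro h
  have h1 := h (show (a, y) ∈ _ from ⟨⟨le_rfl, hab.le⟩, rfl⟩)
  have h2 := h (show (b, y) ∈ _ from ⟨⟨hab.le, le_rfl⟩, rfl⟩)
  exact hab.ne (h1.1.trans h2.1.symm)

lemma IsTiling.exists_segment_vertical (h : f.IsTiling) {x c d : ℝ} (hcd : c < d)
    (hw : {x} ×ˢ Set.Icc c d ⊆ f.walls) : ∃ s, f.IsSegment s ∧ {x} ×ˢ Set.Icc c d ⊆ s := by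
  obtain ⟨⟨hx, hc, hd⟩, hv⟩ := (h.vertical_subset_walls_iff hcd).1 hw
  -- For fixed `c`, each room either imposes nothing or bounds `d'` by its bottom. So a highest
  -- upper end exists by compactness; then the lower end is pushed down likewise.
  have hclosed : IsClosed {d' | f.VFree x c d'} := by
    simp only [VFree, Set.ofPred_forall]
    refine isClosed_biInter fun i _ => isClosed_iInter fun _ => isClosed_iInter fun _ => ?_
    by_cases hi : (f.room i).top ≤ c
    · simp [hi]
    · simp only [hi, imp_false, not_lt]
      exact isClosed_le continuous_id continuous_const
  obtain ⟨d₁, ⟨hd₁, hv₁⟩, hmax⟩ := (isCompact_Icc.inter_right hclosed :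
    IsCompact (Set.Icc d f.box.top ∩ {d' | f.VFree x c d'})).exists_isGreatest
    ⟨d, ⟨le_rfl, hd⟩, hv⟩
  have hclosed' : IsClosed {c' | f.VFree x c' d₁} := by
    simp only [VFree, Set.ofPred_forall]
    refine isClosed_biInter fun i _ => isClosed_iInter fun _ => isClosed_iInter fun _ =>
      isClosed_iInter fun _ => isClosed_le continuous_const continuous_id
  obtain ⟨c₁, ⟨hc₁, hv₂⟩, hmin⟩ := (isCompact_Icc.inter_right hclosed' :
    IsCompact (Set.Icc f.box.bottom c ∩ {c' | f.VFree x c' d₁})).exists_isLeast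
    ⟨c, ⟨hc, le_rfl⟩, hv₁⟩
  have hcd₁ : c₁ < d₁ := by linarith [hc₁.2, hd₁.1]
  refine ⟨{x} ×ˢ Set.Icc c₁ d₁, ⟨⟨.inl ⟨x, c₁, d₁, hcd₁, rfl⟩, ?_⟩, ?_⟩,
    Set.prod_mono le_rfl (Set.Icc_subset_Icc hc₁.2 hd₁.1)⟩
  · exact (h.vertical_subset_walls_iff hcd₁).2 ⟨⟨hx, hc₁.1, hd₁.2⟩, hv₂⟩
  · rintro t ⟨⟨x', a, b, hab, rfl⟩ | ⟨y, a, b, hab, rfl⟩, htw⟩ hst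
    · obtain ⟨rfl, ha, hb⟩ := vertical_subset_vertical hcd₁ hst
      obtain ⟨⟨-, haB, hbT⟩, hv'⟩ := (h.vertical_subset_walls_iff hab).1 htw
      have h1 : b ≤ d₁ := hmax ⟨⟨hd₁.1.trans hb, hbT⟩, hv'.mono (ha.trans hc₁.2) le_rfl⟩
      have h2 : c₁ ≤ a := hmin ⟨⟨haB, ha.trans hc₁.2⟩, hv'.mono le_rfl hb⟩
      exact Set.prod_mono le_rfl (Set.Icc_subset_Icc h2 h1)
    · exact absurd hst (not_vertical_subset_horizontal hcd₁)

lemma IsSegment.eq_vertical {s : Set (ℝ × ℝ)} (hs : f.IsSegment s) {x c d : ℝ} (hcd : c < d)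
    (h : {x} ×ˢ Set.Icc c d ⊆ s) : ∃ c' d', c' < d' ∧ c' ≤ c ∧ d ≤ d' ∧
      s = {x} ×ˢ Set.Icc c' d' := by
  obtain ⟨⟨⟨x', a, b, hab, rfl⟩ | ⟨y, a, b, hab, rfl⟩, -⟩, -⟩ := hs
  · obtain ⟨rfl, h1, h2⟩ := vertical_subset_vertical hcd h
    exact ⟨a, b, hab, h1, h2, rfl⟩
  · exact absurd h (not_vertical_subset_horizontal hcd)

/-- Two segments sharing a nondegenerate piece have a segment in the walls as their union, which
both equal by maximality. -/
lemma IsSegment.unique_vertical {s t : Set (ℝ × ℝ)} (hs : f.IsSegment s) (ht : f.IsSegment t)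
    {x c d : ℝ} (hcd : c < d) (h : {x} ×ˢ Set.Icc c d ⊆ s) (h' : {x} ×ˢ Set.Icc c d ⊆ t) :
    s = t := by
  obtain ⟨a, b, hab, ha, hb, rfl⟩ := hs.eq_vertical hcd h
  obtain ⟨a', b', hab', ha', hb', rfl⟩ := ht.eq_vertical hcd h'
  have hu : ({x} ×ˢ Set.Icc (min a a') (max b b') : Set (ℝ × ℝ)) =
      {x} ×ˢ Set.Icc a b ∪ {x} ×ˢ Set.Icc a' b' := by
    rw [← Set.prod_union, Set.Icc_union_Icc' (by linarith) (by linarith)]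
  have hp : IsAxisSegment ({x} ×ˢ Set.Icc (min a a') (max b b')) ∧
      ({x} ×ˢ Set.Icc (min a a') (max b b') : Set (ℝ × ℝ)) ⊆ f.walls :=
    ⟨.inl ⟨x, _, _, min_lt_of_left_lt (lt_max_of_lt_left hab), rfl⟩,
      hu ▸ Set.union_subset hs.1.2 ht.1.2⟩
  rw [hs.eq_of_subset hp (hu ▸ Set.subset_union_left),
    ht.eq_of_subset hp (hu ▸ Set.subset_union_right)]

/-! ### Segments under the antitransposition -/

/-- The reflection `(x, y) ↦ (-y, -x)` of the plane. -/
def flip (p : ℝ × ℝ) : ℝ × ℝ := (-p.2, -p.1)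

lemma preimage_flip_flip (s : Set (ℝ × ℝ)) : flip ⁻¹' (flip ⁻¹' s) = s := by
  ext ⟨x, y⟩
  simp [flip]

lemma preimage_flip_vertical (x c d : ℝ) :
    flip ⁻¹' ({x} ×ˢ Set.Icc c d) = Set.Icc (-d) (-c) ×ˢ {-x} := by
  ext ⟨x', y⟩
  simp only [flip, Set.mem_preimage, Set.mem_prod, Set.mem_singleton_iff, Set.mem_Icc]
  constructor <;> rintro ⟨h1, h2⟩ <;> constructor <;> grind

lemma preimage_flip_horizontal (y a b : ℝ) :
    flip ⁻¹' (Set.Icc a b ×ˢ {y}) = {-y} ×ˢ Set.Icc (-b) (-a) := by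
  rw [← preimage_flip_flip ({-y} ×ˢ Set.Icc (-b) (-a)), preimage_flip_vertical]
  simp only [neg_neg]

lemma preimage_flip_subset {s t : Set (ℝ × ℝ)} : flip ⁻¹' s ⊆ flip ⁻¹' t ↔ s ⊆ t := by
  refine ⟨fun h => ?_, Set.preimage_mono⟩
  rw [← preimage_flip_flip s, ← preimage_flip_flip t]
  exact Set.preimage_mono h

lemma walls_antitranspose : f.antitranspose.walls = flip ⁻¹' f.walls := by
  ext ⟨x, y⟩
  exact mem_walls_antitranspose

lemma IsAxisSegment.preimage_flip {s : Set (ℝ × ℝ)} (h : IsAxisSegment s) :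
    IsAxisSegment (flip ⁻¹' s) := by
  rcases h with ⟨x, a, b, hab, rfl⟩ | ⟨y, a, b, hab, rfl⟩
  · exact .inr ⟨_, _, _, neg_lt_neg hab, preimage_flip_vertical x a b⟩
  · exact .inl ⟨_, _, _, neg_lt_neg hab, preimage_flip_horizontal y a b⟩

lemma IsSegment.preimage_flip {s : Set (ℝ × ℝ)} (h : f.IsSegment s) :
    f.antitranspose.IsSegment (flip ⁻¹' s) := by
  refine ⟨⟨h.1.1.preimage_flip, ?_⟩, fun t ht hst => ?_⟩
  · rw [walls_antitranspose]
    exact Set.preimage_mono h.1.2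
  · rw [← preimage_flip_flip t, preimage_flip_subset] at hst ⊢
    refine h.2 ⟨ht.1.preimage_flip, ?_⟩ hst
    rw [← preimage_flip_subset, preimage_flip_flip, ← walls_antitranspose]
    exact ht.2

lemma leftEdge_antitranspose (R : Rect) : R.antitranspose.leftEdge = flip ⁻¹' R.topEdge :=
  (preimage_flip_horizontal _ _ _).symm

lemma rightEdge_antitranspose (R : Rect) : R.antitranspose.rightEdge = flip ⁻¹' R.bottomEdge :=
  (preimage_flip_horizontal _ _ _).symm

/-- Some segment contains both sets. -/
def OnCommonSegment (f : Dissection ι) (X Y : Set (ℝ × ℝ)) : Prop :=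
  ∃ s, f.IsSegment s ∧ X ⊆ s ∧ Y ⊆ s

lemma OnCommonSegment.symm {X Y : Set (ℝ × ℝ)} (h : f.OnCommonSegment X Y) :
    f.OnCommonSegment Y X :=
  h.imp fun _ hs => ⟨hs.1, hs.2.2, hs.2.1⟩

lemma onCommonSegment_comm {X Y : Set (ℝ × ℝ)} :
    f.OnCommonSegment X Y ↔ f.OnCommonSegment Y X := ⟨.symm, .symm⟩

lemma OnCommonSegment.preimage_flip {X Y : Set (ℝ × ℝ)} (h : f.OnCommonSegment X Y) :
    f.antitranspose.OnCommonSegment (flip ⁻¹' X) (flip ⁻¹' Y) :=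
  let ⟨s, h1, h2, h3⟩ := h
  ⟨flip ⁻¹' s, h1.preimage_flip, Set.preimage_mono h2, Set.preimage_mono h3⟩

lemma onCommonSegment_antitranspose {X Y : Set (ℝ × ℝ)} :
    f.antitranspose.OnCommonSegment (flip ⁻¹' X) (flip ⁻¹' Y) ↔ f.OnCommonSegment X Y := by
  refine ⟨fun h => ?_, .preimage_flip⟩
  simpa only [antitranspose_antitranspose, preimage_flip_flip] using h.preimage_flip

lemma IsTiling.exists_segment (h : f.IsTiling) {X : Set (ℝ × ℝ)} (hX : IsAxisSegment X)
    (hw : X ⊆ f.walls) : ∃ s, f.IsSegment s ∧ X ⊆ s := by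
  rcases hX with ⟨x, a, b, hab, rfl⟩ | ⟨y, a, b, hab, rfl⟩
  · exact h.exists_segment_vertical hab hw
  · rw [← preimage_flip_subset, preimage_flip_horizontal, ← walls_antitranspose] at hw
    obtain ⟨s, hs, hXs⟩ := h.antitranspose.exists_segment_vertical (neg_lt_neg hab) hw
    refine ⟨flip ⁻¹' s, by simpa using hs.preimage_flip, ?_⟩
    rwa [← preimage_flip_subset, preimage_flip_flip, preimage_flip_horizontal]

lemma IsSegment.unique {s t X : Set (ℝ × ℝ)} (hs : f.IsSegment s) (ht : f.IsSegment t)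
    (hX : IsAxisSegment X) (h : X ⊆ s) (h' : X ⊆ t) : s = t := by
  rcases hX with ⟨x, a, b, hab, rfl⟩ | ⟨y, a, b, hab, rfl⟩
  · exact hs.unique_vertical ht hab h h'
  · rw [← preimage_flip_subset, preimage_flip_horizontal] at h h'
    have := hs.preimage_flip.unique_vertical ht.preimage_flip (neg_lt_neg hab) h h'
    rw [← preimage_flip_flip s, this, preimage_flip_flip]

lemma OnCommonSegment.trans {X Y Z : Set (ℝ × ℝ)} (hY : IsAxisSegment Y)
    (h : f.OnCommonSegment X Y) (h' : f.OnCommonSegment Y Z) : f.OnCommonSegment X Z := by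
  obtain ⟨s, hs, h1, h2⟩ := h
  obtain ⟨t, ht, h3, h4⟩ := h'
  obtain rfl := hs.unique ht hY h2 h3
  exact ⟨s, hs, h1, h4⟩

lemma isAxisSegment_edge {R : Rect} (h : R.Proper) (d : Side) : IsAxisSegment (R.edge d) := by
  cases d
  · exact .inl ⟨_, _, _, h.2, rfl⟩
  · exact .inl ⟨_, _, _, h.2, rfl⟩
  · exact .inr ⟨_, _, _, h.1, rfl⟩
  · exact .inr ⟨_, _, _, h.1, rfl⟩

lemma edge_subset_walls {a : ι} (ha : a ∈ f.rooms) (d : Side) : (f.room a).edge d ⊆ f.walls := by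
  refine Set.Subset.trans ?_ (Set.subset_biUnion_of_mem ha)
  cases d
  · exact fun p hp => .inl (.inl (.inl hp))
  · exact fun p hp => .inl (.inl (.inr hp))
  · exact fun p hp => .inl (.inr hp)
  · exact fun p hp => .inr hp

/-! ### Edges on a common segment -/

lemma IsTiling.onCommonSegment_vertical_iff (h : f.IsTiling) {x x' c d c' d' : ℝ} (hcd : c < d)
    (hcd' : c' < d') (hx : f.box.left ≤ x ∧ x ≤ f.box.right)
    (hc : f.box.bottom ≤ c) (hc' : f.box.bottom ≤ c') (hd : d ≤ f.box.top) (hd' : d' ≤ f.box.top) :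
    f.OnCommonSegment ({x} ×ˢ Set.Icc c d) ({x'} ×ˢ Set.Icc c' d') ↔
      x = x' ∧ f.VFree x (min c c') (max d d') := by
  constructor
  · rintro ⟨s, hs, h1, h2⟩
    obtain ⟨a, b, hab, ha, hb, rfl⟩ := hs.eq_vertical hcd h1
    obtain ⟨rfl, ha', hb'⟩ := vertical_subset_vertical hcd' h2
    exact ⟨rfl, ((h.vertical_subset_walls_iff hab).1 hs.1.2).2.mono (le_min ha ha')
      (max_le hb hb')⟩
  · rintro ⟨rfl, hv⟩
    have hlt : min c c' < max d d' := min_lt_of_left_lt (lt_max_of_lt_left hcd)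
    obtain ⟨s, hs, hss⟩ := h.exists_segment_vertical hlt
      ((h.vertical_subset_walls_iff hlt).2 ⟨⟨hx, le_min hc hc', max_le hd hd'⟩, hv⟩)
    exact ⟨s, hs,
      (Set.prod_mono le_rfl (Set.Icc_subset_Icc (min_le_left _ _) (le_max_left _ _))).trans hss,
      (Set.prod_mono le_rfl (Set.Icc_subset_Icc (min_le_right _ _) (le_max_right _ _))).trans hss⟩

variable {a b : ι}

lemma IsTiling.leftOf_iff_onCommonSegment (h : f.IsTiling) (ha : a ∈ f.rooms) (hb : b ∈ f.rooms) :
    f.LeftOf a b ↔ f.OnCommonSegment (f.room a).rightEdge (f.room b).leftEdge := by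
  have pa := h.room_proper a ha
  have pb := h.room_proper b hb
  have ba := h.room_bounds ha
  have bb := h.room_bounds hb
  rw [Rect.rightEdge, Rect.leftEdge, h.onCommonSegment_vertical_iff pa.2 pb.2
    ⟨ba.1.1.trans pa.1.le, ba.1.2⟩ ba.2.1 bb.2.1 ba.2.2 bb.2.2]
  simp [LeftOf, ha, hb]

/-- Detects the left side of the box by relations alone. Away from that side, the room just left of
and below the top left corner of `a` works: its vertical extent overlaps that of `a`, so no room can
cut the wall between them. -/
lemma IsTiling.exists_leftOf_iff (h : f.IsTiling) (ha : a ∈ f.rooms) :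
    (∃ b : {i // i ∈ f.rooms}, f.LeftOf b a) ↔ f.box.left < (f.room a).left := by
  obtain ⟨pa1, pa2⟩ := h.room_proper a ha
  obtain ⟨⟨ba1, ba2⟩, ba3, ba4⟩ := h.room_bounds ha
  constructor
  · rintro ⟨⟨b, hb⟩, hba⟩
    linarith [hba.2.2.1, (h.room_proper b hb).1, (h.room_bounds hb).1.1]
  · intro hl
    obtain ⟨b, hb, ⟨h1, h2⟩, h3, h4⟩ := h.exists_room_SW (x := (f.room a).left)
      (y := (f.room a).top) hl (by linarith) (by linarith) ba4
    obtain ⟨pb1, pb2⟩ := h.room_proper b hb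
    have hba : b ≠ a := by rintro rfl; linarith
    have hr : (f.room b).right = (f.room a).left := by
      rcases h.separated hb ha hba with h5 | h5 | h5 | h5 <;> linarith
    refine ⟨⟨b, hb⟩, hb, ha, hr, fun i hi h5 h6 h7 => ?_⟩
    obtain ⟨pi1, pi2⟩ := h.room_proper i hi
    have hia : i ≠ a := by rintro rfl; linarith
    have hib : i ≠ b := by rintro rfl; linarith
    have s1 := h.separated hi ha hia
    have s2 := h.separated hi hb hib
    rw [lt_max_iff] at h7
    rw [le_min_iff]
    grind

lemma IsTiling.exists_rightOf_iff (h : f.IsTiling) (ha : a ∈ f.rooms) :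
    (∃ b : {i // i ∈ f.rooms}, f.LeftOf a b) ↔ (f.room a).right < f.box.right := by
  obtain ⟨pa1, pa2⟩ := h.room_proper a ha
  obtain ⟨⟨ba1, ba2⟩, ba3, ba4⟩ := h.room_bounds ha
  constructor
  · rintro ⟨⟨b, hb⟩, hba⟩
    linarith [hba.2.2.1, (h.room_proper b hb).1, (h.room_bounds hb).1.2]
  · intro hl
    obtain ⟨b, hb, ⟨h1, h2⟩, h3, h4⟩ := h.exists_room_SE (x := (f.room a).right)
      (y := (f.room a).top) (by linarith) hl (by linarith) ba4
    obtain ⟨pb1, pb2⟩ := h.room_proper b hb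
    have hba : b ≠ a := by rintro rfl; linarith
    have hr : (f.room a).right = (f.room b).left := by
      rcases h.separated hb ha hba with h5 | h5 | h5 | h5 <;> linarith
    refine ⟨⟨b, hb⟩, ha, hb, hr, fun i hi h5 h6 h7 => ?_⟩
    obtain ⟨pi1, pi2⟩ := h.room_proper i hi
    have hia : i ≠ a := by rintro rfl; linarith
    have hib : i ≠ b := by rintro rfl; linarith
    have s1 := h.separated hi ha hia
    have s2 := h.separated hi hb hib
    rw [lt_max_iff] at h7
    rw [le_min_iff]
    grind

/-- Segments inside the box also have rooms on their left, and any such room witnesses the common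
segment; the left side of the box is the exceptional case without left neighbours. -/
lemma IsTiling.onCommonSegment_left_left_iff (h : f.IsTiling) (ha : a ∈ f.rooms)
    (hb : b ∈ f.rooms) : f.OnCommonSegment (f.room a).leftEdge (f.room b).leftEdge ↔
      (∃ c : {i // i ∈ f.rooms}, f.LeftOf c a ∧ f.LeftOf c b) ∨
      (¬ (∃ c : {i // i ∈ f.rooms}, f.LeftOf c a) ∧
        ¬ ∃ c : {i // i ∈ f.rooms}, f.LeftOf c b) := by
  have pa := h.room_proper a ha
  have pb := h.room_proper b hb
  have ba := h.room_bounds ha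
  have bb := h.room_bounds hb
  have key : f.OnCommonSegment (f.room a).leftEdge (f.room b).leftEdge ↔
      (f.room a).left = (f.room b).left ∧ _ :=
    h.onCommonSegment_vertical_iff pa.2 pb.2
      ⟨ba.1.1, pa.1.le.trans ba.1.2⟩ ba.2.1 bb.2.1 ba.2.2 bb.2.2
  constructor
  · intro hab
    by_cases hc : ∃ c : {i // i ∈ f.rooms}, f.LeftOf c a
    · obtain ⟨c, hc⟩ := hc
      refine .inl ⟨c, hc, (h.leftOf_iff_onCommonSegment c.2 hb).2 ?_⟩
      exact ((h.leftOf_iff_onCommonSegment c.2 ha).1 hc).trans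
        (isAxisSegment_edge pa .left) hab
    · refine .inr ⟨hc, ?_⟩
      rw [h.exists_leftOf_iff ha] at hc
      rwa [h.exists_leftOf_iff hb, ← (key.1 hab).1]
  · rintro (⟨c, h1, h2⟩ | ⟨h1, h2⟩)
    · have pc := h.room_proper c c.2
      exact ((h.leftOf_iff_onCommonSegment c.2 ha).1 h1).symm.trans
        (isAxisSegment_edge pc .right) ((h.leftOf_iff_onCommonSegment c.2 hb).1 h2)
    · rw [h.exists_leftOf_iff ha] at h1
      rw [h.exists_leftOf_iff hb] at h2
      refine key.2 ⟨by linarith [ba.1.1, bb.1.1], fun i hi h3 => ?_⟩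
      linarith [(h.room_bounds hi).1.1]

lemma IsTiling.onCommonSegment_right_right_iff (h : f.IsTiling) (ha : a ∈ f.rooms)
    (hb : b ∈ f.rooms) : f.OnCommonSegment (f.room a).rightEdge (f.room b).rightEdge ↔
      (∃ c : {i // i ∈ f.rooms}, f.LeftOf a c ∧ f.LeftOf b c) ∨
      (¬ (∃ c : {i // i ∈ f.rooms}, f.LeftOf a c) ∧
        ¬ ∃ c : {i // i ∈ f.rooms}, f.LeftOf b c) := by
  have pa := h.room_proper a ha
  have pb := h.room_proper b hb
  have ba := h.room_bounds ha
  have bb := h.room_bounds hb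
  have key : f.OnCommonSegment (f.room a).rightEdge (f.room b).rightEdge ↔
      (f.room a).right = (f.room b).right ∧ _ :=
    h.onCommonSegment_vertical_iff pa.2 pb.2
      ⟨ba.1.1.trans pa.1.le, ba.1.2⟩ ba.2.1 bb.2.1 ba.2.2 bb.2.2
  constructor
  · intro hab
    by_cases hc : ∃ c : {i // i ∈ f.rooms}, f.LeftOf a c
    · obtain ⟨c, hc⟩ := hc
      refine .inl ⟨c, hc, (h.leftOf_iff_onCommonSegment hb c.2).2 ?_⟩
      exact hab.symm.trans (isAxisSegment_edge pa .right)
        ((h.leftOf_iff_onCommonSegment ha c.2).1 hc)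
    · refine .inr ⟨hc, ?_⟩
      rw [h.exists_rightOf_iff ha] at hc
      rwa [h.exists_rightOf_iff hb, ← (key.1 hab).1]
  · rintro (⟨c, h1, h2⟩ | ⟨h1, h2⟩)
    · have pc := h.room_proper c c.2
      exact ((h.leftOf_iff_onCommonSegment ha c.2).1 h1).trans
        (isAxisSegment_edge pc .left) ((h.leftOf_iff_onCommonSegment hb c.2).1 h2).symm
    · rw [h.exists_rightOf_iff ha] at h1
      rw [h.exists_rightOf_iff hb] at h2
      refine key.2 ⟨by linarith [ba.1.2, bb.1.2], fun i hi h3 h4 => ?_⟩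
      linarith [(h.room_bounds hi).1.2]

lemma IsTiling.above_iff_onCommonSegment (h : f.IsTiling) (ha : a ∈ f.rooms) (hb : b ∈ f.rooms) :
    f.Above a b ↔ f.OnCommonSegment (f.room a).bottomEdge (f.room b).topEdge := by
  rw [← leftOf_antitranspose, h.antitranspose.leftOf_iff_onCommonSegment ha hb]
  simp only [antitranspose_room, leftEdge_antitranspose, rightEdge_antitranspose,
    onCommonSegment_antitranspose]

lemma IsTiling.onCommonSegment_top_top_iff (h : f.IsTiling) (ha : a ∈ f.rooms)
    (hb : b ∈ f.rooms) : f.OnCommonSegment (f.room a).topEdge (f.room b).topEdge ↔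
      (∃ c : {i // i ∈ f.rooms}, f.Above c a ∧ f.Above c b) ∨
      (¬ (∃ c : {i // i ∈ f.rooms}, f.Above c a) ∧
        ¬ ∃ c : {i // i ∈ f.rooms}, f.Above c b) := by
  have := h.antitranspose.onCommonSegment_left_left_iff ha hb
  simp only [antitranspose_room, leftEdge_antitranspose, onCommonSegment_antitranspose,
    leftOf_antitranspose] at this
  exact this

lemma IsTiling.onCommonSegment_bottom_bottom_iff (h : f.IsTiling) (ha : a ∈ f.rooms)
    (hb : b ∈ f.rooms) : f.OnCommonSegment (f.room a).bottomEdge (f.room b).bottomEdge ↔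
      (∃ c : {i // i ∈ f.rooms}, f.Above a c ∧ f.Above b c) ∨
      (¬ (∃ c : {i // i ∈ f.rooms}, f.Above a c) ∧
        ¬ ∃ c : {i // i ∈ f.rooms}, f.Above b c) := by
  have := h.antitranspose.onCommonSegment_right_right_iff ha hb
  simp only [antitranspose_room, rightEdge_antitranspose, onCommonSegment_antitranspose,
    leftOf_antitranspose] at this
  exact this

lemma not_onCommonSegment_vertical_horizontal {x c d y u v : ℝ} (hcd : c < d) (huv : u < v) :
    ¬ f.OnCommonSegment ({x} ×ˢ Set.Icc c d) (Set.Icc u v ×ˢ {y}) := by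
  rintro ⟨s, hs, h1, h2⟩
  obtain ⟨a, b, -, -, -, rfl⟩ := hs.eq_vertical hcd h1
  exact not_horizontal_subset_vertical huv h2

/-- Every segment contains an edge of a room. -/
lemma IsTiling.exists_edge_subset (h : f.IsTiling) {s : Set (ℝ × ℝ)} (hs : f.IsSegment s) :
    ∃ a ∈ f.rooms, ∃ d, (f.room a).edge d ⊆ s := by
  have aux : ∀ {g : Dissection ι}, g.IsTiling → ∀ {x c d : ℝ}, c < d →
      g.IsSegment ({x} ×ˢ Set.Icc c d) → ∃ a ∈ g.rooms,
        (g.room a).leftEdge ⊆ {x} ×ˢ Set.Icc c d ∨ (g.room a).rightEdge ⊆ {x} ×ˢ Set.Icc c d := by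
    intro g h x c d hcd hs
    obtain ⟨⟨⟨hL, hR⟩, hB, hT⟩, hv⟩ := (h.vertical_subset_walls_iff hcd).1 hs.1.2
    -- An edge overlapping the segment can be merged with it, so by maximality it is contained in
    -- it.
    have hov : ∀ a ∈ g.rooms, (g.room a).left = x ∨ (g.room a).right = x →
        (g.room a).bottom < d → c < (g.room a).top →
        {x} ×ˢ Set.Icc (g.room a).bottom (g.room a).top ⊆ {x} ×ˢ Set.Icc c d := by
      intro a ha hx h1 h2
      have pa := h.room_proper a ha
      have ba := h.room_bounds ha
      have hfree : g.VFree x (min (g.room a).bottom c) (max (g.room a).top d) := by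
        intro i hi h3 h4 h5
        have hia : i ≠ a := by rintro rfl; rcases hx with hx | hx <;> linarith
        have := h.separated hi ha hia
        have := hv i hi h3 h4
        obtain ⟨pi1, pi2⟩ := h.room_proper i hi
        rw [lt_max_iff] at h5
        rw [le_min_iff]
        obtain ⟨pa1, pa2⟩ := pa
        grind
      obtain ⟨t, ht, h3, h4⟩ := (h.onCommonSegment_vertical_iff (x' := x) pa.2 hcd ⟨hL, hR⟩ ba.2.1
        hB ba.2.2 hT).2 ⟨rfl, hfree⟩
      rwa [← ht.unique hs hs.1.1 h4 subset_rfl]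
    -- Inside the box or on its left side, the room to the right of the lower end has its left edge
    -- here. On the right side of the box, a right edge is used instead.
    rcases hR.lt_or_eq with hx | hx
    · obtain ⟨a, ha, ⟨h1, h2⟩, h3, h4⟩ := h.exists_room_NE hL hx hB (by linarith)
      have hl : (g.room a).left = x := by
        by_contra hne
        linarith [hv a ha (lt_of_le_of_ne h1 hne) h2 (by linarith)]
      refine ⟨a, ha, .inl ?_⟩
      rw [Rect.leftEdge, hl]
      exact hov a ha (.inl hl) (by linarith) h4
    · obtain ⟨a, ha, ⟨h1, h2⟩, h3, h4⟩ := h.exists_room_SW (x := x) (y := d)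
        (by rw [hx]; exact h.box_proper.1) hR (by linarith) hT
      have hr : (g.room a).right = x := le_antisymm (by linarith [(h.room_bounds ha).1.2]) h2
      refine ⟨a, ha, .inr ?_⟩
      rw [Rect.rightEdge, hr]
      exact hov a ha (.inr hr) h3 (by linarith)
  rcases hs.1.1 with ⟨x, c, d, hcd, rfl⟩ | ⟨y, u, v, huv, rfl⟩
  · obtain ⟨a, ha, h1 | h1⟩ := aux h hcd hs
    · exact ⟨a, ha, .left, h1⟩
    · exact ⟨a, ha, .right, h1⟩
  · have hs' := hs.preimage_flip
    rw [preimage_flip_horizontal] at hs'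
    obtain ⟨a, ha, h1⟩ := aux h.antitranspose (neg_lt_neg huv) hs'
    rw [← preimage_flip_horizontal, antitranspose_room, leftEdge_antitranspose,
      rightEdge_antitranspose, preimage_flip_subset, preimage_flip_subset] at h1
    rcases h1 with h1 | h1
    · exact ⟨a, ha, .top, h1⟩
    · exact ⟨a, ha, .bottom, h1⟩

/-! ### Equivalence in terms of the relations -/

theorem Equivalent.exists_isRelIso {g : Dissection κ} (hfg : f.Equivalent g) (hf : f.IsTiling)
    (hg : g.IsTiling) : ∃ e, IsRelIso f g e := by
  obtain ⟨e, φ, H⟩ := hfg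
  refine ⟨e, fun a b => ⟨?_, ?_⟩⟩
  · rw [hf.leftOf_iff_onCommonSegment a.2 b.2, hg.leftOf_iff_onCommonSegment (e a).2 (e b).2]
    constructor
    · rintro ⟨s, hs, h1, h2⟩
      exact ⟨_, (φ ⟨s, hs⟩).2, (H ⟨s, hs⟩ a).2.1.1 h1, (H ⟨s, hs⟩ b).1.1 h2⟩
    · rintro ⟨s, hs, h1, h2⟩
      obtain ⟨t, ht⟩ := φ.surjective ⟨s, hs⟩
      have ht' : (φ t).1 = s := congrArg Subtype.val ht
      exact ⟨t, t.2, (H t a).2.1.2 (ht'.symm ▸ h1), (H t b).1.2 (ht'.symm ▸ h2)⟩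
  · rw [hf.above_iff_onCommonSegment a.2 b.2, hg.above_iff_onCommonSegment (e a).2 (e b).2]
    constructor
    · rintro ⟨s, hs, h1, h2⟩
      exact ⟨_, (φ ⟨s, hs⟩).2, (H ⟨s, hs⟩ a).2.2.1.1 h1, (H ⟨s, hs⟩ b).2.2.2.1 h2⟩
    · rintro ⟨s, hs, h1, h2⟩
      obtain ⟨t, ht⟩ := φ.surjective ⟨s, hs⟩
      have ht' : (φ t).1 = s := congrArg Subtype.val ht
      exact ⟨t, t.2, (H t a).2.2.1.2 (ht'.symm ▸ h1), (H t b).2.2.2.2 (ht'.symm ▸ h2)⟩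

/-- Every coincidence of edges on a segment is expressible by `LeftOf` and `Above`: opposite sides
by the relation itself, equal sides by a common neighbour or the lack of any, and perpendicular
sides never coincide. -/
lemma IsRelIso.onCommonSegment_iff {g : Dissection κ}
    {e : {i // i ∈ f.rooms} ≃ {j // j ∈ g.rooms}} (he : IsRelIso f g e) (hf : f.IsTiling)
    (hg : g.IsTiling) (a b : {i // i ∈ f.rooms}) (d d' : Side) :
    f.OnCommonSegment ((f.room a).edge d) ((f.room b).edge d') ↔
      g.OnCommonSegment ((g.room (e a)).edge d) ((g.room (e b)).edge d') := by
  have hl : ∀ a : {i // i ∈ f.rooms}, (∃ c : {i // i ∈ f.rooms}, f.LeftOf c a) ↔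
      ∃ c : {j // j ∈ g.rooms}, g.LeftOf c (e a) := fun a => e.exists_congr fun c => (he c a).1
  have hr : ∀ a : {i // i ∈ f.rooms}, (∃ c : {i // i ∈ f.rooms}, f.LeftOf a c) ↔
      ∃ c : {j // j ∈ g.rooms}, g.LeftOf (e a) c := fun a => e.exists_congr fun c => (he a c).1
  have ht : ∀ a : {i // i ∈ f.rooms}, (∃ c : {i // i ∈ f.rooms}, f.Above c a) ↔
      ∃ c : {j // j ∈ g.rooms}, g.Above c (e a) := fun a => e.exists_congr fun c => (he c a).2
  have hb : ∀ a : {i // i ∈ f.rooms}, (∃ c : {i // i ∈ f.rooms}, f.Above a c) ↔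
      ∃ c : {j // j ∈ g.rooms}, g.Above (e a) c := fun a => e.exists_congr fun c => (he a c).2
  have hpf := fun a : {i // i ∈ f.rooms} => hf.room_proper a a.2
  have hpg := fun a : {i // i ∈ f.rooms} => hg.room_proper (e a) (e a).2
  cases d <;> cases d'
  · exact (hf.onCommonSegment_left_left_iff a.2 b.2).trans ((or_congr
      (e.exists_congr fun c => and_congr (he c a).1 (he c b).1)
      (and_congr (not_congr (hl a)) (not_congr (hl b)))).trans
      (hg.onCommonSegment_left_left_iff (e a).2 (e b).2).symm)
  · exact onCommonSegment_comm.trans ((hf.leftOf_iff_onCommonSegment b.2 a.2).symm.trans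
      ((he b a).1.trans ((hg.leftOf_iff_onCommonSegment (e b).2 (e a).2).trans
      onCommonSegment_comm)))
  · exact iff_of_false (not_onCommonSegment_vertical_horizontal (hpf a).2 (hpf b).1)
      (not_onCommonSegment_vertical_horizontal (hpg a).2 (hpg b).1)
  · exact iff_of_false (not_onCommonSegment_vertical_horizontal (hpf a).2 (hpf b).1)
      (not_onCommonSegment_vertical_horizontal (hpg a).2 (hpg b).1)
  · exact (hf.leftOf_iff_onCommonSegment a.2 b.2).symm.trans
      ((he a b).1.trans (hg.leftOf_iff_onCommonSegment (e a).2 (e b).2))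
  · exact (hf.onCommonSegment_right_right_iff a.2 b.2).trans ((or_congr
      (e.exists_congr fun c => and_congr (he a c).1 (he b c).1)
      (and_congr (not_congr (hr a)) (not_congr (hr b)))).trans
      (hg.onCommonSegment_right_right_iff (e a).2 (e b).2).symm)
  · exact iff_of_false (not_onCommonSegment_vertical_horizontal (hpf a).2 (hpf b).1)
      (not_onCommonSegment_vertical_horizontal (hpg a).2 (hpg b).1)
  · exact iff_of_false (not_onCommonSegment_vertical_horizontal (hpf a).2 (hpf b).1)
      (not_onCommonSegment_vertical_horizontal (hpg a).2 (hpg b).1)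
  · exact iff_of_false
      (fun h => not_onCommonSegment_vertical_horizontal (hpf b).2 (hpf a).1 h.symm)
      (fun h => not_onCommonSegment_vertical_horizontal (hpg b).2 (hpg a).1 h.symm)
  · exact iff_of_false
      (fun h => not_onCommonSegment_vertical_horizontal (hpf b).2 (hpf a).1 h.symm)
      (fun h => not_onCommonSegment_vertical_horizontal (hpg b).2 (hpg a).1 h.symm)
  · exact (hf.onCommonSegment_bottom_bottom_iff a.2 b.2).trans ((or_congr
      (e.exists_congr fun c => and_congr (he a c).2 (he b c).2)
      (and_congr (not_congr (hb a)) (not_congr (hb b)))).trans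
      (hg.onCommonSegment_bottom_bottom_iff (e a).2 (e b).2).symm)
  · exact (hf.above_iff_onCommonSegment a.2 b.2).symm.trans
      ((he a b).2.trans (hg.above_iff_onCommonSegment (e a).2 (e b).2))
  · exact iff_of_false
      (fun h => not_onCommonSegment_vertical_horizontal (hpf b).2 (hpf a).1 h.symm)
      (fun h => not_onCommonSegment_vertical_horizontal (hpg b).2 (hpg a).1 h.symm)
  · exact iff_of_false
      (fun h => not_onCommonSegment_vertical_horizontal (hpf b).2 (hpf a).1 h.symm)
      (fun h => not_onCommonSegment_vertical_horizontal (hpg b).2 (hpg a).1 h.symm)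
  · exact onCommonSegment_comm.trans ((hf.above_iff_onCommonSegment b.2 a.2).symm.trans
      ((he b a).2.trans ((hg.above_iff_onCommonSegment (e b).2 (e a).2).trans
      onCommonSegment_comm)))
  · exact (hf.onCommonSegment_top_top_iff a.2 b.2).trans ((or_congr
      (e.exists_congr fun c => and_congr (he c a).2 (he c b).2)
      (and_congr (not_congr (ht a)) (not_congr (ht b)))).trans
      (hg.onCommonSegment_top_top_iff (e a).2 (e b).2).symm)

/-- The segment through an edge of a room. -/
lemma IsTiling.exists_segmentOf (h : f.IsTiling) :
    ∃ S : {i // i ∈ f.rooms} → Side → {s // f.IsSegment s},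
      ∀ (a : {i // i ∈ f.rooms}) (d : Side) (s : {s // f.IsSegment s}),
      (f.room a).edge d ⊆ s.1 ↔ S a d = s := by
  have hex := fun (a : {i // i ∈ f.rooms}) d => h.exists_segment
    (isAxisSegment_edge (h.room_proper a a.2) d) (edge_subset_walls a.2 d)
  choose S hS hsub using hex
  refine ⟨fun a d => ⟨S a d, hS a d⟩, fun a d s => ⟨fun hs => Subtype.ext ?_, ?_⟩⟩
  · exact (hS a d).unique s.2 (isAxisSegment_edge (h.room_proper a a.2) d) (hsub a d) hs
  · rintro rfl
    exact hsub a d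

/-- Segments are the classes of pairs (room, side) under lying on a common segment: each edge is in
exactly one segment, and each segment contains an edge. The matching of rooms respects these classes
and so induces a bijection of segments. -/
theorem IsRelIso.equivalent {g : Dissection κ}
    {e : {i // i ∈ f.rooms} ≃ {j // j ∈ g.rooms}} (he : IsRelIso f g e) (hf : f.IsTiling)
    (hg : g.IsTiling) : f.Equivalent g := by
  obtain ⟨S, hS⟩ := hf.exists_segmentOf
  obtain ⟨S', hS'⟩ := hg.exists_segmentOf
  have hker : ∀ (a b : {i // i ∈ f.rooms}) (d d' : Side), S a d = S b d' ↔ S' (e a) d = S' (e b) d' := by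
    intro a b d d'
    have h1 : f.OnCommonSegment ((f.room a).edge d) ((f.room b).edge d') ↔ S a d = S b d' := by
      rw [← hS]
      exact ⟨fun ⟨s, hs, ha, hb⟩ => by rwa [(hS b d' ⟨s, hs⟩).1 hb],
        fun ha => ⟨_, (S b d').2, ha, (hS b d' _).2 rfl⟩⟩
    have h2 : g.OnCommonSegment ((g.room (e a)).edge d) ((g.room (e b)).edge d') ↔
        S' (e a) d = S' (e b) d' := by
      rw [← hS']
      exact ⟨fun ⟨s, hs, ha, hb⟩ => by rwa [(hS' (e b) d' ⟨s, hs⟩).1 hb],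
        fun ha => ⟨_, (S' (e b) d').2, ha, (hS' (e b) d' _).2 rfl⟩⟩
    rw [← h1, ← h2]
    exact he.onCommonSegment_iff hf hg a b d d'
  have hsurj : ∀ s, ∃ p : {i // i ∈ f.rooms} × Side, S p.1 p.2 = s := fun s =>
    let ⟨a, ha, d, hd⟩ := hf.exists_edge_subset s.2
    ⟨(⟨a, ha⟩, d), (hS _ _ _).1 hd⟩
  choose p hp using hsurj
  let φ : {s // f.IsSegment s} → {s // g.IsSegment s} := fun s => S' (e (p s).1) (p s).2
  -- The map `φ` does not depend on the edge chosen to represent a segment.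
  have hφ : ∀ a d, φ (S a d) = S' (e a) d := fun a d => (hker _ _ _ _).1 (hp _)
  have hbij : Function.Bijective φ := by
    refine ⟨fun s t hst => ?_, fun t => ?_⟩
    · rw [← hp s, ← hp t]
      exact (hker _ _ _ _).2 hst
    · obtain ⟨b, hb, d, hd⟩ := hg.exists_edge_subset t.2
      refine ⟨S (e.symm ⟨b, hb⟩) d, ?_⟩
      rw [hφ, e.apply_symm_apply]
      exact (hS' _ _ _).1 hd
  have hedge : ∀ (s : {s // f.IsSegment s}) (a : {i // i ∈ f.rooms}) d, (f.room a).edge d ⊆ s.1 ↔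
      (g.room (e a)).edge d ⊆ (φ s).1 := by
    intro s a d
    rw [hS, hS', ← hφ, hbij.injective.eq_iff]
  exact ⟨e, Equiv.ofBijective φ hbij, fun s a =>
    ⟨hedge s a .left, hedge s a .right, hedge s a .bottom, hedge s a .top⟩⟩

end Dissection

end Floorplan

theorem theorem9 {ι κ : Type*} [DecidableEq ι] [DecidableEq κ] {n : ℕ}
    (π : Equiv.Perm (Fin n)) (hπ : Floorplan.IsBaxter π) :
    Floorplan.IsBaxter (Floorplan.reverse π) ∧
    ∀ f : Floorplan.Dissection ι, f.CorrespondsTo π →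
      f.rotateCW.reflectVertical.CorrespondsTo (Floorplan.reverse π) ∧
      ∀ g : Floorplan.Dissection κ, g.IsMosaic →
        (g.CorrespondsTo (Floorplan.reverse π) ↔ g.Equivalent f.rotateCW.reflectVertical) := by
  refine ⟨hπ.reverse, fun f hf => ?_⟩
  -- The composite `(x, y) ↦ (y, -x) ↦ (-y, -x)` is antitransposition by definition.
  change f.antitranspose.CorrespondsTo _ ∧ ∀ g : Floorplan.Dissection κ, g.IsMosaic →
    (g.CorrespondsTo (Floorplan.reverse π) ↔ g.Equivalent f.antitranspose)
  have hf' := hf.antitranspose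
  have ht := hf'.1.isTiling
  refine ⟨hf', fun g hg => ⟨fun hg' => ?_, fun hg' => ?_⟩⟩
  · obtain ⟨e, he⟩ := hg'.exists_isRelIso hf'
    exact he.equivalent hg.isTiling ht
  · obtain ⟨e, he⟩ := hg'.exists_isRelIso hg.isTiling ht
    exact hf'.of_isRelIso hg he.symm
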